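/- Let $M$ be a smooth manifold of dimension $n+1$; all objects are smooth. A \emph{Veronese web} on $M$ is a family $\{\mathcal F_\lambda\}_{\lambda\in\mathbb R\cup\{\infty\}}$ of foliations of codimension $1$ such that near every point there is a local coframe $\alpha_0,\dots,\alpha_n$ with $(T\mathcal F_\lambda)^\perp=\langle\alpha_0+\lambda\alpha_1+\cdots+\lambda^n\alpha_n\rangle$ for all $\lambda\in\mathbb R$ and $(T\mathcal F_\infty)^\perp=\langle\alpha_n\rangle$. A \emph{partial Nijenhuis operator} (PNO) on $M$ is a pair $(\mathcal F,\bar J)$ consisting of a foliation $\mathcal F$ and a bundle map $\bar J:T\mathcal F\to TM$ such that for all sections $X,Y$ of $T\mathcal F$ the field $[X,Y]_{\bar J}:=[\bar JX,Y]+[X,\bar JY]-\bar J[X,Y]$ is a section of $T\mathcal F$ and $[\bar JX,\bar JY]=\bar J[X,Y]_{\bar J}$. It is of \emph{generic type} (a single Kronecker block) if near every point there are local frames $v_1,\dots,v_n$ of $T\mathcal F$ and $w_0,\dots,w_n$ of $TM$ with $\bar Jv_k=w_{k-1}$ and $v_k=w_k$ for $k=1,\dots,n$; in particular $\mathcal F$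 then has codimension $1$. A \emph{Nijenhuis operator} on an open set $U$ is a $(1,1)$-tensor $J$ on $U$ with $[JX,JY]=J\big([JX,Y]+[X,JY]-J[X,Y]\big)$ for all vector fields $X,Y$. \textbf{Theorem.} There is a bijection between the Veronese webs $\{\mathcal F_\lambda\}$ on $M$ and the PNOs $(\mathcal F,\bar J)$ of generic type on $M$ such that, whenever $\{\mathcal F_\lambda\}$ corresponds to $(\mathcal F,\bar J)$, one has $$\mathcal F_\infty=\mathcal F,\qquad T\mathcal F_0=\bar J\,T\mathcal F,\qquad T\mathcal F_\lambda=(\bar J-\lambda I)\,T\mathcal F\quad(\lambda\in\mathbb R),$$ where $I:T\mathcal F\to TM$ is the inclusion. Moreover, for all pairwise distinct nonzero real numbers $\lambda_1,\dots,\lambda_{n+1}$ and every point of $M$, there are local coordinates $(x_1,\dots,x_{n+1})$ on a neighbourhood $U$ of that point with $T\mathcal F_{\lambda_i}=\ker dx_i$ on $U$ for all $i$, and a Nijenhuis operator $J$ on $U$ with $J\partial_{x_i}=\lambda_i\partial_{x_i}$ for all $i$, such that on $U$ one has $\bar J=J|_{T\mathcal F}$, this restriction is injective, and $J(T\mathcal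 F)=T\mathcal F_0$ (so that $J(T\mathcal F)$ is an integrable distribution). -/

import Mathlib

open scoped Manifold ContDiff

noncomputable section

namespace VeroneseWebs

variable {m : ℕ} {M : Type*} [TopologicalSpace M] [ChartedSpace (EuclideanSpace ℝ (Fin m)) M]
  [IsManifold (𝓡 m) ∞ M]

/-- `X` restricts to a smooth vector field on the set `U`. -/
def SmoothFieldOn (X : ∀ x : M, TangentSpace (𝓡 m) x) (U : Set M) : Prop :=
  ContMDiffOn (𝓡 m) (𝓡 m).tangent ∞ (fun x => (⟨x, X x⟩ : TangentBundle (𝓡 m) M)) U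

/-- `α` restricts to a smooth 1-form on the open set `U`: its value on every smooth vector field
defined on an open subset of `U` is a smooth function. -/
def SmoothOneFormOn (α : ∀ x : M, Module.Dual ℝ (TangentSpace (𝓡 m) x)) (U : Set M) : Prop :=
  ∀ V : Set M, IsOpen V → V ⊆ U → ∀ X : (∀ x : M, TangentSpace (𝓡 m) x), SmoothFieldOn X V →
    ContMDiffOn (𝓡 m) 𝓘(ℝ) ∞ (fun x => α x (X x)) V

variable (m M) in
/-- A smooth foliation of codimension `q` on the `m`-dimensional manifold `M`, given by local
submersions to `ℝ^q` whose fibres are the plaques. It is recorded through its tangent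
distribution `T`, which determines the leaves: near every point `T` is the kernel of the
differential of a submersion. -/
@[ext]
structure Foliation (q : ℕ) where
  /-- the tangent distribution -/
  T : ∀ x : M, Submodule ℝ (TangentSpace (𝓡 m) x)
  exists_submersion : ∀ x : M, ∃ U : Set M, IsOpen U ∧ x ∈ U ∧
    ∃ f : M → EuclideanSpace ℝ (Fin q), ContMDiffOn (𝓡 m) (𝓡 q) ∞ f U ∧
      ∀ y ∈ U, Function.Surjective (mfderiv (𝓡 m) (𝓡 q) f y) ∧
        T y = LinearMap.ker (mfderiv (𝓡 m) (𝓡 q) f y).toLinearMap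

/-- `X` restricts on `U` to a smooth section of the tangent distribution of the foliation `F`. -/
def Foliation.IsSectionOn {q : ℕ} (F : Foliation m M q) (X : ∀ x : M, TangentSpace (𝓡 m) x)
    (U : Set M) : Prop :=
  SmoothFieldOn X U ∧ ∀ x ∈ U, X x ∈ F.T x

/-- A partial operator `A x : T x → T_x M`, applied to a tangent vector `v` at `x`. It is only
meaningful for `v ∈ T x`; the value at other vectors is set to `0` and is irrelevant. -/
def partialApply {T : ∀ x : M, Submodule ℝ (TangentSpace (𝓡 m) x)}
    (A : ∀ x : M, T x →ₗ[ℝ] TangentSpace (𝓡 m) x) (x : M) (v : TangentSpace (𝓡 m) x) :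
    TangentSpace (𝓡 m) x :=
  open Classical in if h : v ∈ T x then A x ⟨v, h⟩ else 0

/-- The bracket `[X, Y]_A = [A X, Y] + [X, A Y] - A [X, Y]` of two vector fields, for a family of
maps `A x : T_x M → T_x M`. -/
def deformedBracket (A : ∀ x : M, TangentSpace (𝓡 m) x → TangentSpace (𝓡 m) x)
    (X Y : ∀ x : M, TangentSpace (𝓡 m) x) (x : M) : TangentSpace (𝓡 m) x :=
  VectorField.mlieBracket (𝓡 m) (fun y => A y (X y)) Y x
    + VectorField.mlieBracket (𝓡 m) X (fun y => A y (Y y)) x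
    - A x (VectorField.mlieBracket (𝓡 m) X Y x)

/-- The Nijenhuis torsion `N_A(X, Y) = [A X, A Y] - A [X, Y]_A`. -/
def nijenhuisTorsion (A : ∀ x : M, TangentSpace (𝓡 m) x → TangentSpace (𝓡 m) x)
    (X Y : ∀ x : M, TangentSpace (𝓡 m) x) (x : M) : TangentSpace (𝓡 m) x :=
  VectorField.mlieBracket (𝓡 m) (fun y => A y (X y)) (fun y => A y (Y y)) x
    - A x (deformedBracket A X Y x)

/-- `J` restricts to a Nijenhuis operator on the open set `U`: a smooth (1,1)-tensor with
vanishing Nijenhuis torsion. -/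
structure IsNijenhuisOperatorOn
    (J : ∀ x : M, TangentSpace (𝓡 m) x →ₗ[ℝ] TangentSpace (𝓡 m) x) (U : Set M) : Prop where
  smooth : ∀ V : Set M, IsOpen V → V ⊆ U → ∀ X : (∀ x : M, TangentSpace (𝓡 m) x),
    SmoothFieldOn X V → SmoothFieldOn (fun x => J x (X x)) V
  torsion_eq_zero : ∀ V : Set M, IsOpen V → V ⊆ U → ∀ X Y : (∀ x : M, TangentSpace (𝓡 m) x),
    SmoothFieldOn X V → SmoothFieldOn Y V →
      ∀ x ∈ V, nijenhuisTorsion (fun y v => J y v) X Y x = 0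

variable (m M) in
/-- A partial Nijenhuis operator `(F, J)`: a foliation `F` of codimension `q` together with a
smooth bundle map `J : TF → TM` such that, for all (local) smooth sections `X`, `Y` of `TF`,
`[X, Y]_J` is a section of `TF` and `N_J(X, Y) = 0`. (The tangent distribution of a foliation
is involutive, so `J [X, Y]` makes sense.) -/
@[ext]
structure PartialNijenhuisOperator (q : ℕ) where
  F : Foliation m M q
  J : ∀ x : M, F.T x →ₗ[ℝ] TangentSpace (𝓡 m) x
  smooth : ∀ U : Set M, IsOpen U → ∀ X : (∀ x : M, TangentSpace (𝓡 m) x),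
    F.IsSectionOn X U → SmoothFieldOn (fun x => partialApply J x (X x)) U
  bracket_mem : ∀ U : Set M, IsOpen U → ∀ X Y : (∀ x : M, TangentSpace (𝓡 m) x),
    F.IsSectionOn X U → F.IsSectionOn Y U →
      ∀ x ∈ U, deformedBracket (partialApply J) X Y x ∈ F.T x
  torsion_eq_zero : ∀ U : Set M, IsOpen U → ∀ X Y : (∀ x : M, TangentSpace (𝓡 m) x),
    F.IsSectionOn X U → F.IsSectionOn Y U →
      ∀ x ∈ U, nijenhuisTorsion (partialApply J) X Y x = 0

/-- The subspace `(J - c I) T_x F` of `T_x M`, where `I : T_x F → T_x M` is the inclusion. -/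
def PartialNijenhuisOperator.shiftedImage {q : ℕ} (P : PartialNijenhuisOperator m M q) (c : ℝ)
    (x : M) : Submodule ℝ (TangentSpace (𝓡 m) x) :=
  LinearMap.range (P.J x - c • (P.F.T x).subtype)

section Dimension

variable {n : ℕ} {N : Type*} [TopologicalSpace N]
  [ChartedSpace (EuclideanSpace ℝ (Fin (n + 1))) N] [IsManifold (𝓡 (n + 1)) ∞ N]

/-- Generic type: the pair `J, I : TF → TM` is a single Kronecker block. Near every point there
are smooth local frames `v_1, …, v_n` of `TF` and `w_0, …, w_n` of `TM` with
`J v_k = w_{k-1}` and `I v_k = w_k` for `k = 1, …, n`. -/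
def PartialNijenhuisOperator.IsGeneric {q : ℕ} (P : PartialNijenhuisOperator (n + 1) N q) : Prop :=
  ∀ x : N, ∃ U : Set N, IsOpen U ∧ x ∈ U ∧
    ∃ (v : Fin n → ∀ y : N, TangentSpace (𝓡 (n + 1)) y)
      (w : Fin (n + 1) → ∀ y : N, TangentSpace (𝓡 (n + 1)) y),
      (∀ k, SmoothFieldOn (v k) U) ∧ (∀ k, SmoothFieldOn (w k) U) ∧
      ∀ y ∈ U,
        (LinearIndependent ℝ (fun k => v k y) ∧
          Submodule.span ℝ (Set.range fun k => v k y) = P.F.T y) ∧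
        (LinearIndependent ℝ (fun k => w k y) ∧
          Submodule.span ℝ (Set.range fun k => w k y) = ⊤) ∧
        (∀ k : Fin n, partialApply P.J y (v k y) = w k.castSucc y) ∧
        (∀ k : Fin n, v k y = w k.succ y)

/-- The point of the Veronese curve with coefficients `a_0, …, a_n` at `c ∈ ℝ ∪ {∞}`:
`a_0 + c a_1 + ⋯ + c^n a_n` for real `c`, and `a_n` for `c = ∞`. -/
def veroneseCurve {V : Type*} [AddCommGroup V] [Module ℝ V] (a : Fin (n + 1) → V) :
    OnePoint ℝ → V
  | none => a (Fin.last n)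
  | some c => ∑ i : Fin (n + 1), c ^ (i : ℕ) • a i

variable (n N) in
/-- A Veronese web on the `(n+1)`-dimensional manifold `N`: a family of codimension 1 foliations
indexed by the real projective line `ℝ ∪ {∞}` such that near every point there is a smooth local
coframe `α_0, …, α_n` for which the annihilator of `T F_c` is spanned by
`α_0 + c α_1 + ⋯ + c^n α_n`. -/
@[ext]
structure VeroneseWeb where
  F : OnePoint ℝ → Foliation (n + 1) N 1
  exists_coframe : ∀ x : N, ∃ U : Set N, IsOpen U ∧ x ∈ U ∧
    ∃ α : Fin (n + 1) → ∀ y : N, Module.Dual ℝ (TangentSpace (𝓡 (n + 1)) y),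
      (∀ i, SmoothOneFormOn (α i) U) ∧
      ∀ y ∈ U, LinearIndependent ℝ (fun i => α i y) ∧
        ∀ c : OnePoint ℝ, ((F c).T y).dualAnnihilator =
          Submodule.span ℝ {veroneseCurve (fun i => α i y) c}

end Dimension

/-- The coordinate vector `∂/∂x_i` at the point `y` of the coordinate domain of the chart `φ`. -/
def coordVector (φ : OpenPartialHomeomorph M (EuclideanSpace ℝ (Fin m))) (i : Fin m) (y : M) :
    TangentSpace (𝓡 m) y :=
  (mfderiv (𝓡 m) (𝓡 m) φ y).inverse (EuclideanSpace.single i (1 : ℝ))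

/-- The kernel at `y` of the differential of the `i`-th coordinate function of the chart `φ`, i.e.
the tangent space at `y` of the coordinate hypersurface `x_i = const`. -/
def coordHyperplane (φ : OpenPartialHomeomorph M (EuclideanSpace ℝ (Fin m))) (i : Fin m) (y : M) :
    Submodule ℝ (TangentSpace (𝓡 m) y) :=
  LinearMap.ker (mfderiv (𝓡 m) 𝓘(ℝ) (fun z => φ z i) y).toLinearMap

end VeroneseWebs

end

/-! Pointwise, the two structures carry the same linear algebra. Let X_0, …, X_n be the frame dual
to the coframe α_0, …, α_n, put α_c = Σ c^i α_i and T = ker α_n, and let J : T → TM send X_k to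
X_{k+1}. Since α_0 J = 0, α_{k+1} J = α_k and α_n = 0 on T, one gets α_c(Jv) = c α_c(v) on T. So J -
c maps T into ker α_c, and onto it by injectivity and dimension (`IsDualFrame.range_shift`).
Conversely, these relations for n+1 values of c determine J by Vandermonde
(`IsDualFrame.operator_unique`). Hence web and operator determine each other, and J does not depend
on the coframe. What remains is integrability.

From webs to operators (`VeroneseWeb.exists_nijenhuis`,
`VeroneseWeb.exists_partialNijenhuisOperator`): first integrals x_i of F_{λ_i}, for n+1 distinct
λ_i, form a chart, and there dx_i(Jv) = λ_i dx_i(v). So J is the restriction of a constant diagonal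
operator N, whose torsion vanishes. If all λ_i are nonzero, N is injective. Then N[X,Y]_N = [NX,NY]
lies in TF_0 = N(TF), because F_0 is a foliation, and injectivity puts [X,Y]_N in TF.

From operators to webs (`PartialNijenhuisOperator.mlieBracket_shiftedField_mem`): the axioms give
[(J-c)X, (J-c)Y] = (J-c)([X,Y]_J - c[X,Y]), so (J-c)TF is an involutive hyperplane field. It is
integrable by the Frobenius theorem in codimension one (`exists_first_integral`), proved here by
lifting radial segments horizontally. The smooth dependence of the lift on its end point comes from
the inverse function theorem in a Banach space of continuous curves, which is why superposition
operators are studied first. -/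

noncomputable section

namespace VeroneseWebs

open Topology Filter Set

/-! ### Smoothness of superposition operators on spaces of continuous functions. -/

section Superposition

variable {K : Type*} [TopologicalSpace K] [CompactSpace K]
variable {E F : Type*} [NormedAddCommGroup E] [NormedSpace ℝ E]
  [NormedAddCommGroup F] [NormedSpace ℝ F]

variable (K E F) in
/-- Pointwise evaluation of a continuous family of operators on a continuous curve. -/
def pointwiseApplyCLM : C(K, E →L[ℝ] F) →L[ℝ] C(K, E) →L[ℝ] C(K, F) :=
  LinearMap.mkContinuous₂
    (LinearMap.mk₂ ℝ (fun (A : C(K, E →L[ℝ] F)) (γ : C(K, E)) =>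
        (⟨fun t => A t (γ t), by fun_prop⟩ : C(K, F)))
      (by intros; ext; simp) (by intros; ext; simp) (by intros; ext; simp) (by intros; ext; simp))
    1 (by
      intro A γ
      rw [ContinuousMap.norm_le _ (by positivity)]
      intro t
      rw [one_mul]
      exact ((A t).le_opNorm _).trans
        (mul_le_mul (A.norm_coe_le_norm t) (γ.norm_coe_le_norm t) (norm_nonneg _) (by positivity)))

@[simp]
lemma pointwiseApplyCLM_apply (A : C(K, E →L[ℝ] F)) (γ : C(K, E)) (t : K) :
    pointwiseApplyCLM K E F A γ t = A t (γ t) := rfl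

/-- Superposition with a `C^1` map is differentiable on spaces of continuous functions. -/
lemma hasFDerivAt_continuousMap_comp (g : C(E, F)) (g' : C(E, E →L[ℝ] F))
    (hg : ∀ x, HasFDerivAt g (g' x) x) (γ : C(K, E)) :
    HasFDerivAt (fun γ : C(K, E) => g.comp γ) (pointwiseApplyCLM K E F (g'.comp γ)) γ := by
  rw [hasFDerivAt_iff_isLittleO, Asymptotics.isLittleO_iff]
  intro ε hε
  -- Compactness of the image of γ makes the continuity of g' uniform along it, so that one δ serves
  -- all t.
  have hc : IsCompact (range γ) := isCompact_range γ.continuous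
  have hu := hc.uniformContinuousAt_of_continuousAt g' (fun x _ => g'.continuous.continuousAt)
    (Metric.dist_mem_uniformity hε)
  obtain ⟨δ, hδ, hu⟩ := Metric.mem_uniformity_dist.1 hu
  filter_upwards [Metric.ball_mem_nhds γ hδ] with η hη
  rw [ContinuousMap.norm_le _ (by positivity)]
  intro t
  have hball : ∀ x ∈ Metric.ball (γ t) δ, ‖g' x - g' (γ t)‖ ≤ ε := by
    intro x hx
    have := hu (a := γ t) (b := x) (by rwa [dist_comm]) (mem_range_self t)
    rw [← dist_eq_norm, dist_comm]
    exact le_of_lt this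
  have hηt : η t ∈ Metric.ball (γ t) δ :=
    lt_of_le_of_lt (ContinuousMap.dist_apply_le_dist t) hη
  have key := (convex_ball (γ t) δ).norm_image_sub_le_of_norm_hasFDerivWithin_le'
    (f := g) (f' := g') (φ := g' (γ t)) (C := ε)
    (fun x _ => (hg x).hasFDerivWithinAt) hball (Metric.mem_ball_self hδ) hηt
  refine key.trans ?_
  gcongr
  exact (η - γ).norm_coe_le_norm t

-- Induction on the order of differentiability: the derivative is a continuous linear function of
-- the superposition with `fderiv ℝ g`. That map takes values in E →L[ℝ] F, so F must vary in the
-- induction, and a common universe keeps the new target admissible.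
universe u in
lemma contDiff_continuousMap_comp_nat {E : Type u} [NormedAddCommGroup E] [NormedSpace ℝ E]
    (n : ℕ) : ∀ {F : Type u} [NormedAddCommGroup F] [NormedSpace ℝ F] (g : C(E, F)),
      ContDiff ℝ n g → ContDiff ℝ n (fun γ : C(K, E) => g.comp γ) := by
  induction n with
  | zero =>
    intro F _ _ g _
    simp only [Nat.cast_zero, contDiff_zero]
    exact ContinuousMap.continuous_postcomp g
  | succ n ih =>
    intro F _ _ g hg
    have hg1 : ContDiff ℝ ((n : WithTop ℕ∞) + 1) g := by exact_mod_cast hg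
    have hd : ContDiff ℝ n (fderiv ℝ g) := hg1.fderiv_right le_rfl
    let g' : C(E, E →L[ℝ] F) := ⟨fderiv ℝ g, hd.continuous⟩
    have h1 := ih g' hd
    push_cast
    rw [contDiff_succ_iff_hasFDerivAt]
    have h2 : ContDiff ℝ n (fun A => pointwiseApplyCLM K E F A) :=
      by apply ContinuousLinearMap.contDiff
    exact ⟨fun γ => pointwiseApplyCLM K E F (g'.comp γ),
      h2.comp h1,
      fun γ => hasFDerivAt_continuousMap_comp g g'
        (fun x => ((hg1.differentiable (by simp)) x).hasFDerivAt) γ⟩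

universe u in
/-- Superposition with a smooth map is smooth on spaces of continuous functions. -/
theorem contDiff_continuousMap_comp {E F : Type u} [NormedAddCommGroup E] [NormedSpace ℝ E]
    [NormedAddCommGroup F] [NormedSpace ℝ F] (g : C(E, F)) (hg : ContDiff ℝ ∞ g) :
    ContDiff ℝ ∞ (fun γ : C(K, E) => g.comp γ) :=
  contDiff_infty.2 fun n => contDiff_continuousMap_comp_nat n g (contDiff_infty.1 hg n)

end Superposition

/-! ### Integration as an operator on C([0,1]). -/

section Primitive

/-- The primitive vanishing at `0` of a continuous function on `[0, 1]`. -/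
def primitiveCLM : C(Icc (0 : ℝ) 1, ℝ) →L[ℝ] C(Icc (0 : ℝ) 1, ℝ) :=
  LinearMap.mkContinuous
    { toFun := fun z => ⟨fun t => ∫ s in (0 : ℝ)..t, IccExtend zero_le_one z s, by
        have hc : Continuous (IccExtend (zero_le_one (α := ℝ)) z) := z.continuous.Icc_extend'
        exact (intervalIntegral.continuous_primitive
          (fun a b => hc.intervalIntegrable a b) 0).comp continuous_subtype_val⟩
      map_add' := by
        intro z w
        ext t
        have hz : Continuous (IccExtend (zero_le_one (α := ℝ)) z) := z.continuous.Icc_extend'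
        have hw : Continuous (IccExtend (zero_le_one (α := ℝ)) w) := w.continuous.Icc_extend'
        exact intervalIntegral.integral_add (hz.intervalIntegrable _ _) (hw.intervalIntegrable _ _)
      map_smul' := by
        intro c z
        ext t
        exact intervalIntegral.integral_const_mul c _ }
    1 (by
      intro z
      rw [ContinuousMap.norm_le _ (by positivity)]
      intro t
      have := intervalIntegral.norm_integral_le_of_norm_le_const (a := 0) (b := t)
        (f := IccExtend zero_le_one z) (C := ‖z‖) (fun s _ => z.norm_coe_le_norm _)
      refine this.trans ?_
      rw [one_mul, sub_zero, abs_of_nonneg t.2.1]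
      exact mul_le_of_le_one_right (norm_nonneg _) t.2.2)

lemma primitiveCLM_apply (z : C(Icc (0 : ℝ) 1, ℝ)) (t : Icc (0 : ℝ) 1) :
    primitiveCLM z t = ∫ s in (0 : ℝ)..t, IccExtend zero_le_one z s := rfl

/-- The integrand is extended by constants outside [0,1], so the derivative is two-sided even at the
end points. -/
lemma hasDerivAt_integral_IccExtend (z : C(Icc (0 : ℝ) 1, ℝ)) (t : ℝ) :
    HasDerivAt (fun t => ∫ s in (0 : ℝ)..t, IccExtend zero_le_one z s)
      (IccExtend zero_le_one z t) t := by
  have hc : Continuous (IccExtend (zero_le_one (α := ℝ)) z) := z.continuous.Icc_extend'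
  exact hc.integral_hasStrictDerivAt 0 t |>.hasDerivAt

end Primitive

/-! ### The Frobenius theorem in codimension one. -/

section Frobenius

variable {E : Type} [NormedAddCommGroup E] [NormedSpace ℝ E]

/-- The curves `s ↦ ((1 - s) h + z(s) e, h)`, linearly parametrised by `(h, z)`. -/
def contractingCurve (e : E) : E × C(Icc (0 : ℝ) 1, ℝ) →L[ℝ] C(Icc (0 : ℝ) 1, E × E) :=
  LinearMap.mkContinuous
    { toFun := fun q => ⟨fun s => ((1 - (s : ℝ)) • q.1 + q.2 s • e, q.1), by fun_prop⟩
      map_add' := by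
        intro q r
        ext s
        · simp only [Prod.fst_add, Prod.snd_add, ContinuousMap.add_apply, ContinuousMap.coe_mk,
            Prod.mk_add_mk]
          module
        · simp
      map_smul' := by
        intro c q
        ext s
        · simp only [Prod.smul_fst, Prod.smul_snd, ContinuousMap.smul_apply, ContinuousMap.coe_mk,
            Prod.smul_mk, RingHom.id_apply, smul_eq_mul]
          module
        · simp }
    (1 + ‖e‖) (by
      intro q
      rw [ContinuousMap.norm_le _ (by positivity)]
      intro s
      have h1 : ‖q.1‖ ≤ ‖q‖ := norm_fst_le q
      have h2 : ‖q.2 s‖ ≤ ‖q‖ := (q.2.norm_coe_le_norm s).trans (norm_snd_le q)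
      have hs : |1 - (s : ℝ)| ≤ 1 := by
        rw [abs_le]; constructor <;> linarith [s.2.1, s.2.2]
      have h3 : ‖(1 - (s : ℝ)) • q.1 + q.2 s • e‖ ≤ (1 + ‖e‖) * ‖q‖ := by
        refine (norm_add_le _ _).trans ?_
        rw [norm_smul, norm_smul, Real.norm_eq_abs]
        have := mul_le_mul hs h1 (norm_nonneg _) zero_le_one
        have := mul_le_mul_of_nonneg_right h2 (norm_nonneg e)
        linarith
      refine max_le h3 ?_
      have := mul_nonneg (norm_nonneg e) (norm_nonneg q)
      change ‖q.1‖ ≤ _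
      linarith)

lemma contractingCurve_apply (e : E) (q : E × C(Icc (0 : ℝ) 1, ℝ)) (s : Icc (0 : ℝ) 1) :
    contractingCurve e q s = ((1 - (s : ℝ)) • q.1 + q.2 s • e, q.1) := rfl

/-- The integrand `(p, h) ↦ b_p(h)`. -/
def formEval (b : E → E →L[ℝ] ℝ) (hb : ContDiff ℝ ∞ b) : C(E × E, ℝ) :=
  ⟨fun q => b q.1 q.2, by have := hb.continuous; fun_prop⟩

lemma contDiff_formEval {b : E → E →L[ℝ] ℝ} (hb : ContDiff ℝ ∞ b) :
    ContDiff ℝ ∞ (formEval b hb) := by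
  change ContDiff ℝ ∞ (fun q : E × E => b q.1 q.2)
  fun_prop

lemma hasFDerivAt_formEval {b : E → E →L[ℝ] ℝ} (hb : ContDiff ℝ ∞ b) (q : E × E) :
    HasFDerivAt (formEval b hb)
      ((b q.1).comp (ContinuousLinearMap.snd ℝ E E) +
        ((fderiv ℝ b q.1).comp (ContinuousLinearMap.fst ℝ E E)).flip q.2) q := by
  have h1 : HasFDerivAt (fun q : E × E => b q.1)
      ((fderiv ℝ b q.1).comp (ContinuousLinearMap.fst ℝ E E)) q :=
    ((hb.differentiable (by simp)) q.1).hasFDerivAt.comp q hasFDerivAt_fst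
  exact h1.clm_apply hasFDerivAt_snd

lemma fderiv_formEval_apply {b : E → E →L[ℝ] ℝ} (hb : ContDiff ℝ ∞ b) (q r : E × E) :
    fderiv ℝ (formEval b hb) q r = b q.1 r.2 + fderiv ℝ b q.1 r.1 q.2 := by
  rw [(hasFDerivAt_formEval hb q).fderiv]
  simp

/-- The map `(h, z) ↦ (h, z - ∫ b_γ(h))` with `γ(s) = (1 - s) h + z(s) e`. Its zeroes in the second
component are the horizontal lifts, in the direction `e`, of the radial segments. -/
def liftEquation (b : E → E →L[ℝ] ℝ) (hb : ContDiff ℝ ∞ b) (e : E)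
    (q : E × C(Icc (0 : ℝ) 1, ℝ)) : E × C(Icc (0 : ℝ) 1, ℝ) :=
  (q.1, q.2 - primitiveCLM ((formEval b hb).comp (contractingCurve e q)))

lemma contDiff_liftEquation {b : E → E →L[ℝ] ℝ} (hb : ContDiff ℝ ∞ b) (e : E) :
    ContDiff ℝ ∞ (liftEquation b hb e) := by
  have h := (contDiff_continuousMap_comp (K := Icc (0 : ℝ) 1) _ (contDiff_formEval hb)).comp
    (contractingCurve e).contDiff
  exact contDiff_fst.prodMk (contDiff_snd.sub (primitiveCLM.contDiff.comp h))

/-- The derivative of the integral term of `liftEquation`. -/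
def liftIntegralDeriv (b : E → E →L[ℝ] ℝ) (hb : ContDiff ℝ ∞ b) (e : E)
    (q : E × C(Icc (0 : ℝ) 1, ℝ)) : E × C(Icc (0 : ℝ) 1, ℝ) →L[ℝ] C(Icc (0 : ℝ) 1, ℝ) :=
  primitiveCLM.comp ((pointwiseApplyCLM _ _ _
    ((⟨fderiv ℝ (formEval b hb), (contDiff_formEval hb).continuous_fderiv (by simp)⟩ :
      C(E × E, E × E →L[ℝ] ℝ)).comp (contractingCurve e q))).comp (contractingCurve e))

lemma hasFDerivAt_liftIntegral {b : E → E →L[ℝ] ℝ} (hb : ContDiff ℝ ∞ b) (e : E)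
    (q : E × C(Icc (0 : ℝ) 1, ℝ)) :
    HasFDerivAt (fun q => primitiveCLM ((formEval b hb).comp (contractingCurve e q)))
      (liftIntegralDeriv b hb e q) q := by
  have h := hasFDerivAt_continuousMap_comp (K := Icc (0 : ℝ) 1) (formEval b hb)
    ⟨fderiv ℝ (formEval b hb), (contDiff_formEval hb).continuous_fderiv (by simp)⟩
    (fun x => ((contDiff_formEval hb).differentiable (by simp) x).hasFDerivAt)
    (contractingCurve e q)
  exact primitiveCLM.hasFDerivAt.comp q (h.comp q (contractingCurve e).hasFDerivAt)

/-- A variation of z enters the derivative of b_γ(h) only through the term Db(z e)(h), which is zero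
at h = 0. This is what makes the derivative of `liftEquation` at the origin a shear, hence
invertible. -/
lemma liftIntegralDeriv_zero (b : E → E →L[ℝ] ℝ) (hb : ContDiff ℝ ∞ b) (e : E)
    (r : E × C(Icc (0 : ℝ) 1, ℝ)) :
    liftIntegralDeriv b hb e 0 r = liftIntegralDeriv b hb e 0 (r.1, 0) := by
  have : ∀ s, fderiv ℝ (formEval b hb) (contractingCurve e 0 s) (contractingCurve e r s) =
      fderiv ℝ (formEval b hb) (contractingCurve e 0 s) (contractingCurve e (r.1, 0) s) := by
    intro s
    rw [fderiv_formEval_apply, fderiv_formEval_apply]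
    simp [contractingCurve_apply]
  change primitiveCLM _ = primitiveCLM _
  congr 1
  ext s
  exact this s

/-- The derivative of `liftEquation` at the origin, a shear. -/
def liftShear (b : E → E →L[ℝ] ℝ) (hb : ContDiff ℝ ∞ b) (e : E) :
    (E × C(Icc (0 : ℝ) 1, ℝ)) ≃L[ℝ] E × C(Icc (0 : ℝ) 1, ℝ) :=
  ContinuousLinearEquiv.equivOfInverse
    ((ContinuousLinearMap.fst ℝ _ _).prod
      (ContinuousLinearMap.snd ℝ _ _ - liftIntegralDeriv b hb e 0))
    ((ContinuousLinearMap.fst ℝ _ _).prod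
      (ContinuousLinearMap.snd ℝ _ _ + liftIntegralDeriv b hb e 0))
    (by
      intro r
      ext1
      · rfl
      · change r.2 - liftIntegralDeriv b hb e 0 r +
          liftIntegralDeriv b hb e 0 (r.1, r.2 - liftIntegralDeriv b hb e 0 r) = r.2
        rw [liftIntegralDeriv_zero b hb e (r.1, r.2 - liftIntegralDeriv b hb e 0 r),
          liftIntegralDeriv_zero b hb e r]
        abel)
    (by
      intro r
      ext1
      · rfl
      · change r.2 + liftIntegralDeriv b hb e 0 r -
          liftIntegralDeriv b hb e 0 (r.1, r.2 + liftIntegralDeriv b hb e 0 r) = r.2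
        rw [liftIntegralDeriv_zero b hb e (r.1, r.2 + liftIntegralDeriv b hb e 0 r),
          liftIntegralDeriv_zero b hb e r]
        abel)

lemma hasFDerivAt_liftEquation {b : E → E →L[ℝ] ℝ} (hb : ContDiff ℝ ∞ b) (e : E) :
    HasFDerivAt (liftEquation b hb e)
      (liftShear b hb e : E × C(Icc (0 : ℝ) 1, ℝ) →L[ℝ] E × C(Icc (0 : ℝ) 1, ℝ)) 0 :=
  hasFDerivAt_fst.prodMk (hasFDerivAt_snd.sub (hasFDerivAt_liftIntegral hb e 0))

lemma liftEquation_zero (b : E → E →L[ℝ] ℝ) (hb : ContDiff ℝ ∞ b) (e : E) :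
    liftEquation b hb e 0 = 0 := by
  have : (formEval b hb).comp (contractingCurve e 0) = 0 := by
    ext s
    simp [formEval]
  rw [liftEquation, this, map_zero]
  simp

/-- The solution of the lift equation depends smoothly on the end point. -/
lemma exists_smooth_lift [CompleteSpace E] {b : E → E →L[ℝ] ℝ} (hb : ContDiff ℝ ∞ b) (e : E) :
    ∃ z : E → C(Icc (0 : ℝ) 1, ℝ), z 0 = 0 ∧ ∀ᶠ h in 𝓝 (0 : E), ContDiffAt ℝ ∞ z h ∧
      z h = primitiveCLM ((formEval b hb).comp (contractingCurve e (h, z h))) := by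
  have hc : ContDiffAt ℝ ∞ (liftEquation b hb e) 0 := (contDiff_liftEquation hb e).contDiffAt
  let Θ := hc.toOpenPartialHomeomorph (liftEquation b hb e) (hasFDerivAt_liftEquation hb e)
    (by simp)
  have hsource : (0 : E × C(Icc (0 : ℝ) 1, ℝ)) ∈ Θ.source :=
    hc.mem_toOpenPartialHomeomorph_source (hasFDerivAt_liftEquation hb e) (by simp)
  have hΘ0 : Θ 0 = 0 := liftEquation_zero b hb e
  have htarget : (0 : E × C(Icc (0 : ℝ) 1, ℝ)) ∈ Θ.target := by
    have := Θ.map_source hsource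
    rwa [hΘ0] at this
  have hsymm0 : Θ.symm 0 = 0 := by
    have := Θ.left_inv hsource
    rwa [hΘ0] at this
  let ι : E → E × C(Icc (0 : ℝ) 1, ℝ) := fun h => (h, 0)
  have hι : ContDiff ℝ ∞ ι := contDiff_id.prodMk contDiff_const
  have hopen : IsOpen {A : E × C(Icc (0 : ℝ) 1, ℝ) →L[ℝ] E × C(Icc (0 : ℝ) 1, ℝ) |
      A.IsInvertible} := by
    exact ContinuousLinearEquiv.isOpen
  -- The local inverse must be smooth at all points near 0 and not only at 0, so the invertibility
  -- of the derivative is propagated by openness.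
  have hinv : ∀ᶠ q in 𝓝 (0 : E × C(Icc (0 : ℝ) 1, ℝ)),
      (fderiv ℝ (liftEquation b hb e) q).IsInvertible := by
    have hcont := (contDiff_liftEquation hb e).continuous_fderiv (by simp)
    refine hcont.continuousAt.eventually_mem (hopen.mem_nhds ?_)
    rw [(hasFDerivAt_liftEquation hb e).fderiv]
    exact ⟨_, rfl⟩
  have htend : Tendsto (fun h => Θ.symm (ι h)) (𝓝 0) (𝓝 0) := by
    have h1 : ContinuousAt Θ.symm (ι 0) := Θ.continuousAt_symm htarget
    have := h1.comp hι.continuous.continuousAt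
    have h2 : (Θ.symm ∘ ι) 0 = 0 := hsymm0
    rw [ContinuousAt, h2] at this
    exact this
  refine ⟨fun h => (Θ.symm (ι h)).2, ?_, ?_⟩
  · change (Θ.symm 0).2 = 0
    rw [hsymm0]; rfl
  filter_upwards [htend.eventually hinv,
    hι.continuous.continuousAt.eventually_mem (Θ.open_target.mem_nhds htarget)] with h hh ht
  obtain ⟨A, hA⟩ := hh
  have hs : ContDiffAt ℝ ∞ Θ.symm (ι h) := by
    refine Θ.contDiffAt_symm ht (f₀' := A) ?_ (contDiff_liftEquation hb e).contDiffAt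
    rw [hA]
    exact ((contDiff_liftEquation hb e).differentiable (by simp) _).hasFDerivAt
  have heq : liftEquation b hb e (Θ.symm (ι h)) = ι h := Θ.right_inv ht
  have h1 : (Θ.symm (ι h)).1 = h := congrArg Prod.fst heq
  have h2 : (Θ.symm (ι h)).2 -
      primitiveCLM ((formEval b hb).comp (contractingCurve e (Θ.symm (ι h)))) = 0 :=
    congrArg Prod.snd heq
  refine ⟨(hs.comp h hι.contDiffAt).snd, ?_⟩
  have h3 : (h, (Θ.symm (ι h)).2) = Θ.symm (ι h) := Prod.ext h1.symm rfl
  rw [h3]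
  exact sub_eq_zero.1 h2

/-- The linearised lift equation. -/
lemma fderiv_lift {b : E → E →L[ℝ] ℝ} (hb : ContDiff ℝ ∞ b) {e : E}
    {z : E → C(Icc (0 : ℝ) 1, ℝ)} {h : E} (hz : DifferentiableAt ℝ z h)
    (heq : ∀ᶠ h' in 𝓝 h, z h' = primitiveCLM ((formEval b hb).comp (contractingCurve e (h', z h'))))
    (u : E) : fderiv ℝ z h u = liftIntegralDeriv b hb e (h, z h) (u, fderiv ℝ z h u) := by
  have h1 : HasFDerivAt (fun h' : E => (h', z h'))
      ((ContinuousLinearMap.id ℝ E).prod (fderiv ℝ z h)) h :=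
    (hasFDerivAt_id h).prodMk hz.hasFDerivAt
  have h2 := (hasFDerivAt_liftIntegral hb e (h, z h)).comp h h1
  have h3 : HasFDerivAt z _ h := h2.congr_of_eventuallyEq heq
  exact (congrArg (fun A => A u) (h3.unique hz.hasFDerivAt)).symm

/-- The value at time `1` of the lift is constant along the hyperplanes `ker b`. -/
lemma lift_deriv_eq_zero {b : E → E →L[ℝ] ℝ} (hb : ContDiff ℝ ∞ b) {e : E} {r : ℝ}
    (hbe : ∀ p ∈ Metric.ball (0 : E) r, b p e = 1)
    (hclosed : ∀ p ∈ Metric.ball (0 : E) r, ∀ u v, b p u = 0 → b p v = 0 →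
      fderiv ℝ b p u v = fderiv ℝ b p v u)
    {z : E → C(Icc (0 : ℝ) 1, ℝ)} {h : E} (hz : DifferentiableAt ℝ z h)
    (heq : ∀ᶠ h' in 𝓝 h, z h' = primitiveCLM ((formEval b hb).comp (contractingCurve e (h', z h'))))
    (hball : ‖h‖ + ‖z h‖ * ‖e‖ < r) {u : E} (hu : b h u = 0) :
    fderiv ℝ z h u ⟨1, by simp⟩ = 0 := by
  set Z := fderiv ℝ z h with hZ
  have hZu : Z u = liftIntegralDeriv b hb e (h, z h) (u, Z u) := fderiv_lift hb hz heq u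
  have hzh := heq.self_of_nhds
  set G : C(Icc (0 : ℝ) 1, ℝ) := (formEval b hb).comp (contractingCurve e (h, z h)) with hG
  set D : C(Icc (0 : ℝ) 1, ℝ) := pointwiseApplyCLM _ _ _
    ((⟨fderiv ℝ (formEval b hb), (contDiff_formEval hb).continuous_fderiv (by simp)⟩ :
      C(E × E, E × E →L[ℝ] ℝ)).comp (contractingCurve e (h, z h)))
      (contractingCurve e (u, Z u)) with hD
  have hZu' : Z u = primitiveCLM D := hZu
  let ζ : ℝ → ℝ := fun t => ∫ s in (0 : ℝ)..t, IccExtend zero_le_one G s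
  let η : ℝ → ℝ := fun t => ∫ s in (0 : ℝ)..t, IccExtend zero_le_one D s
  have hζd : ∀ t, HasDerivAt ζ (IccExtend zero_le_one G t) t := hasDerivAt_integral_IccExtend G
  have hηd : ∀ t, HasDerivAt η (IccExtend zero_le_one D t) t := hasDerivAt_integral_IccExtend D
  have hζ : ∀ t : Icc (0 : ℝ) 1, z h t = ζ t := fun t => by rw [hzh]; rfl
  have hη : ∀ t : Icc (0 : ℝ) 1, Z u t = η t := fun t => by rw [hZu']; rfl
  -- γ is the lifted curve, running from h to a point of the line ℝe, and V is its variation when h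
  -- moves in the direction u.
  let γ : ℝ → E := fun t => (1 - t) • h + ζ t • e
  let V : ℝ → E := fun t => (1 - t) • u + η t • e
  have hγball : ∀ t ∈ Icc (0 : ℝ) 1, γ t ∈ Metric.ball (0 : E) r := by
    intro t ht
    rw [mem_ball_zero_iff]
    refine lt_of_le_of_lt ((norm_add_le _ _).trans ?_) hball
    rw [norm_smul, norm_smul]
    have h1 : ‖1 - t‖ ≤ 1 := by rw [Real.norm_eq_abs, abs_le]; constructor <;> linarith [ht.1, ht.2]
    have h2 : ‖ζ t‖ ≤ ‖z h‖ := by rw [← hζ ⟨t, ht⟩]; exact (z h).norm_coe_le_norm _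
    have := mul_le_mul_of_nonneg_right h1 (norm_nonneg h)
    have := mul_le_mul_of_nonneg_right h2 (norm_nonneg e)
    linarith
  have hGt : ∀ t ∈ Icc (0 : ℝ) 1, IccExtend zero_le_one G t = b (γ t) h := by
    intro t ht
    rw [IccExtend_of_mem _ _ ht]
    change b ((1 - t) • h + (z h ⟨t, ht⟩) • e) h = _
    rw [hζ]
  have hDt : ∀ t ∈ Icc (0 : ℝ) 1,
      IccExtend zero_le_one D t = b (γ t) u + fderiv ℝ b (γ t) (V t) h := by
    intro t ht
    rw [IccExtend_of_mem _ _ ht]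
    change fderiv ℝ (formEval b hb) ((1 - t) • h + (z h ⟨t, ht⟩) • e, h)
      ((1 - t) • u + (Z u ⟨t, ht⟩) • e, u) = _
    rw [fderiv_formEval_apply, hζ, hη]
  -- differentiate `b(e) = 1`
  have hde : ∀ p ∈ Metric.ball (0 : E) r, ∀ v, fderiv ℝ b p v e = 0 := by
    intro p hp v
    have h1 : HasFDerivAt (fun p => b p e) ((fderiv ℝ b p).flip e) p := by
      have := ((hb.differentiable (by simp)) p).hasFDerivAt.clm_apply (hasFDerivAt_const e p)
      simpa using this
    have h2 : HasFDerivAt (fun p => b p e) (0 : E →L[ℝ] ℝ) p := by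
      refine (hasFDerivAt_const (1 : ℝ) p).congr_of_eventuallyEq ?_
      filter_upwards [Metric.isOpen_ball.mem_nhds hp] with q hq using hbe q hq
    have := congrArg (fun A => A v) (h1.unique h2)
    simpa using this
  let γ' : ℝ → E := fun t => -h + (b (γ t) h) • e
  have hγd : ∀ t ∈ Icc (0 : ℝ) 1, HasDerivAt γ (γ' t) t := by
    intro t ht
    have h1 : HasDerivAt (fun t : ℝ => (1 - t) • h) ((-1 : ℝ) • h) t :=
      ((hasDerivAt_id t).const_sub 1).smul_const h
    have h2 := h1.add ((hζd t).smul_const e)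
    rw [hGt t ht, neg_one_smul] at h2
    exact h2
  have hVd : ∀ t ∈ Icc (0 : ℝ) 1,
      HasDerivAt V (-u + (b (γ t) u + fderiv ℝ b (γ t) (V t) h) • e) t := by
    intro t ht
    have h1 : HasDerivAt (fun t : ℝ => (1 - t) • u) ((-1 : ℝ) • u) t :=
      ((hasDerivAt_id t).const_sub 1).smul_const u
    have h2 := h1.add ((hηd t).smul_const e)
    rw [hDt t ht, neg_one_smul] at h2
    exact h2
  -- w = b(V) solves a linear homogeneous equation w' = -k w: both γ' and V - w e lie in ker b,
  -- where Db is symmetric, and Db( · )(e) = 0 because b(e) = 1. As w(0) = b_h(u) = 0, Grönwall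
  -- gives w = 0, and w(1) is the required derivative because V(1) = η(1) e.
  let w : ℝ → ℝ := fun t => b (γ t) (V t)
  let k : ℝ → ℝ := fun t => fderiv ℝ b (γ t) e (γ' t)
  have hwd : ∀ t ∈ Icc (0 : ℝ) 1, HasDerivAt w (-(k t) * w t) t := by
    intro t ht
    have hp := hγball t ht
    have h1 : HasDerivAt (fun t => b (γ t)) (fderiv ℝ b (γ t) (γ' t)) t :=
      ((hb.differentiable (by simp)) (γ t)).hasFDerivAt.comp_hasDerivAt t (hγd t ht)
    have h2 := h1.clm_apply (hVd t ht)
    refine h2.congr_deriv ?_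
    have hγker : b (γ t) (γ' t) = 0 := by
      simp only [γ', map_add, map_neg, map_smul, hbe _ hp]
      simp
    have hVker : b (γ t) (V t - w t • e) = 0 := by
      simp only [map_sub, map_smul, hbe _ hp, w]
      simp
    have h3 := hclosed _ hp _ _ hγker hVker
    have h4 : fderiv ℝ b (γ t) (V t) (γ' t) = - fderiv ℝ b (γ t) (V t) h := by
      simp only [γ', map_add, map_neg, map_smul, hde _ hp]
      simp
    simp only [map_sub, map_smul, sub_apply, smul_apply,
      hde _ hp, h4, smul_eq_mul] at h3
    rw [map_add (b (γ t)), map_neg, map_smul, hbe _ hp, smul_eq_mul]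
    change _ = -(fderiv ℝ b (γ t) e (γ' t)) * w t
    linarith
  have hγc : ContinuousOn γ (Icc 0 1) := fun t ht => (hγd t ht).continuousAt.continuousWithinAt
  have hkc : ContinuousOn k (Icc 0 1) := by
    have hb1 := hb.continuous
    have hb2 := hb.continuous_fderiv (by simp)
    have h1 : ContinuousOn (fun t => fderiv ℝ b (γ t)) (Icc 0 1) := hb2.comp_continuousOn hγc
    have h2 : ContinuousOn (fun t => b (γ t)) (Icc 0 1) := hb1.comp_continuousOn hγc
    have h3 : ContinuousOn γ' (Icc 0 1) := by fun_prop
    exact (h1.clm_apply continuousOn_const).clm_apply h3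
  obtain ⟨C, hC⟩ := isCompact_Icc.exists_bound_of_continuousOn hkc
  have hw0 : w 0 = 0 := by
    have h1 : γ 0 = h := by simp [γ, ζ]
    have h2 : V 0 = u := by simp [V, η]
    simp only [w, h1, h2, hu]
  have hw1 := eq_zero_of_abs_deriv_le_mul_abs_self_of_eq_zero_right (f := w)
    (f' := fun t => -(k t) * w t) (K := C) (a := 0) (b := 1)
    (fun t ht => (hwd t ht).continuousAt.continuousWithinAt)
    (fun t ht => (hwd t ⟨ht.1, ht.2.le⟩).hasDerivWithinAt) hw0
    (fun t ht => by
      rw [norm_mul, norm_neg]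
      exact mul_le_mul_of_nonneg_right (hC t ⟨ht.1, ht.2.le⟩) (norm_nonneg _)) 1 (by simp)
  have h1 : w 1 = η 1 := by
    simp only [w, V, sub_self, zero_smul, zero_add, map_smul, hbe _ (hγball 1 (by simp))]
    simp
  rw [hη]
  exact h1.symm.trans hw1

/-- The first integral sends h to the coordinate z(1) of the point of ℝe where the horizontal curve
issued from h ends. By `lift_deriv_eq_zero` its differential kills ker b, and it does not kill e
near 0. -/
lemma exists_first_integral_normalized [CompleteSpace E] {b : E → E →L[ℝ] ℝ}
    (hb : ContDiff ℝ ∞ b) {e : E} {r : ℝ} (hr : 0 < r)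
    (hbe : ∀ p ∈ Metric.ball (0 : E) r, b p e = 1)
    (hclosed : ∀ p ∈ Metric.ball (0 : E) r, ∀ u v, b p u = 0 → b p v = 0 →
      fderiv ℝ b p u v = fderiv ℝ b p v u) :
    ∃ f : E → ℝ, ∀ᶠ h in 𝓝 (0 : E), ContDiffAt ℝ ∞ f h ∧ fderiv ℝ f h ≠ 0 ∧
      ∀ u, fderiv ℝ f h u = 0 ↔ b h u = 0 := by
  obtain ⟨z, hz0, hz⟩ := exists_smooth_lift hb e
  let ev : C(Icc (0 : ℝ) 1, ℝ) →L[ℝ] ℝ := ContinuousMap.evalCLM ℝ ⟨1, by simp⟩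
  let f : E → ℝ := fun h => ev (z h)
  have hzc : ContDiffAt ℝ ∞ z 0 := hz.self_of_nhds.1
  have hfc : ∀ h, ContDiffAt ℝ ∞ z h → ContDiffAt ℝ ∞ f h := fun h hh =>
    ContDiffAt.comp h (ContDiff.contDiffAt (by apply ContinuousLinearMap.contDiff)) hh
  have hfd : ∀ h, ContDiffAt ℝ ∞ z h → fderiv ℝ f h = ev.comp (fderiv ℝ z h) := fun h hh =>
    (ev.hasFDerivAt.comp h (hh.differentiableAt (by simp)).hasFDerivAt).fderiv
  have hball : ∀ᶠ h in 𝓝 (0 : E), ‖h‖ + ‖z h‖ * ‖e‖ < r := by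
    have hc : ContinuousAt (fun h : E => ‖h‖ + ‖z h‖ * ‖e‖) 0 :=
      continuousAt_id.norm.add (hzc.continuousAt.norm.mul continuousAt_const)
    refine hc.eventually_lt continuousAt_const ?_
    simpa [hz0] using hr
  have hker : ∀ᶠ h in 𝓝 (0 : E), ∀ u, b h u = 0 → fderiv ℝ f h u = 0 := by
    filter_upwards [hball, hz, hz.eventually_nhds] with h h1 h2 h3 u hu
    rw [hfd h h2.1]
    exact lift_deriv_eq_zero hb hbe hclosed (h2.1.differentiableAt (by simp))
      (h3.mono fun _ h => h.2) h1 hu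
  -- At h = 0 the linearised integrand in the direction e is the constant b(e) = 1, whose integral
  -- over [0,1] is 1.
  have hfe0 : fderiv ℝ f 0 e = 1 := by
    have h1 := fderiv_lift hb (hzc.differentiableAt (by simp)) (hz.mono fun _ h => h.2) e
    rw [hz0] at h1
    rw [hfd 0 hzc]
    change fderiv ℝ z 0 e ⟨1, _⟩ = 1
    rw [h1]
    change primitiveCLM _ _ = 1
    have h2 : ∀ q : E × C(Icc (0 : ℝ) 1, ℝ), q.1 = e → (pointwiseApplyCLM _ _ _
        ((⟨fderiv ℝ (formEval b hb), (contDiff_formEval hb).continuous_fderiv (by simp)⟩ :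
        C(E × E, E × E →L[ℝ] ℝ)).comp (contractingCurve e (0, 0))) (contractingCurve e q)) = 1 := by
      intro q hq
      ext s
      change fderiv ℝ (formEval b hb) (contractingCurve e 0 s) (contractingCurve e q s) = 1
      rw [fderiv_formEval_apply]
      simp [contractingCurve_apply, hq, hbe 0 (Metric.mem_ball_self hr)]
    erw [h2 _ rfl]
    rw [primitiveCLM_apply]
    simp [IccExtend]
  have hfe : ∀ᶠ h in 𝓝 (0 : E), fderiv ℝ f h e ≠ 0 := by
    have h1 : ContinuousAt (fun h => fderiv ℝ f h) 0 :=
      ((hfc 0 hzc).fderiv_right (m := 0) (by simp)).continuousAt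
    refine (h1.clm_apply continuousAt_const).eventually_ne ?_
    rw [hfe0]; exact one_ne_zero
  refine ⟨f, ?_⟩
  filter_upwards [hz, hker, hfe, Metric.ball_mem_nhds 0 hr] with h h1 h2 h3 h4
  refine ⟨hfc h h1.1, fun h0 => h3 (by rw [h0]; rfl), fun u => ⟨fun hu => ?_, h2 u⟩⟩
  -- The vector u - b(u)e lies in ker b, so df(u) = b(u) df(e), which gives the converse inclusion
  -- of kernels.
  have h5 := h2 (u - b h u • e) (by simp [hbe h h4])
  rw [map_sub, map_smul, hu, zero_sub, neg_eq_zero, smul_eq_mul, mul_eq_zero] at h5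
  exact h5.resolve_right h3

/-- **Frobenius theorem in codimension one.** A nowhere vanishing smooth 1-form `α` such that `dα`
vanishes on `ker α` admits local first integrals. -/
theorem exists_first_integral [FiniteDimensional ℝ E] {α : E → E →L[ℝ] ℝ} {p₀ : E}
    (hα : ∀ᶠ p in 𝓝 p₀, ContDiffAt ℝ ∞ α p) (h0 : α p₀ ≠ 0)
    (hclosed : ∀ᶠ p in 𝓝 p₀, ∀ u v, α p u = 0 → α p v = 0 →
      fderiv ℝ α p u v = fderiv ℝ α p v u) :
    ∃ f : E → ℝ, ∀ᶠ p in 𝓝 p₀, ContDiffAt ℝ ∞ f p ∧ fderiv ℝ f p ≠ 0 ∧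
      ∀ u, fderiv ℝ f p u = 0 ↔ α p u = 0 := by
  have : CompleteSpace E := FiniteDimensional.complete ℝ E
  obtain ⟨e, he⟩ : ∃ e, α p₀ e ≠ 0 := by
    by_contra! h
    exact h0 (ContinuousLinearMap.ext h)
  have hev : ∀ᶠ p in 𝓝 p₀, α p e ≠ 0 :=
    (hα.self_of_nhds.continuousAt.clm_apply continuousAt_const).eventually_ne he
  have hall := (hα.and (hclosed.and hev)).eventually_nhds
  have htr : Tendsto (fun p : E => p₀ + p) (𝓝 0) (𝓝 p₀) := by
    have : ContinuousAt (fun p : E => p₀ + p) 0 := by fun_prop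
    simpa [ContinuousAt] using this
  obtain ⟨R, hR, hRs⟩ := Metric.eventually_nhds_iff_ball.1 (htr.eventually hall)
  -- The superposition argument needs a globally smooth form. The form is translated to the origin,
  -- divided by α(e) and cut off: the support stays within R/2 < R, where α is smooth, and nothing
  -- changes within R/3.
  let χ : ContDiffBump (0 : E) := ⟨R / 3, R / 2, by positivity, by linarith⟩
  let β : E → E →L[ℝ] ℝ := fun p => (α (p₀ + p) e)⁻¹ • α (p₀ + p)
  let b : E → E →L[ℝ] ℝ := fun p => χ p • β p
  have hβ : ∀ p ∈ Metric.ball (0 : E) R, ContDiffAt ℝ ∞ β p := by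
    intro p hp
    obtain ⟨h1, -, h2⟩ := (hRs p hp).self_of_nhds
    have h3 : ContDiffAt ℝ ∞ (fun p => α (p₀ + p)) p :=
      ContDiffAt.comp p h1 (contDiffAt_const.add contDiffAt_id)
    exact ((h3.clm_apply contDiffAt_const).inv h2).smul h3
  have hb : ContDiff ℝ ∞ b := by
    refine contDiff_iff_contDiffAt.2 fun p => ?_
    by_cases h1 : p ∈ tsupport χ
    swap
    · refine contDiffAt_const (c := 0) |>.congr_of_eventuallyEq ?_
      filter_upwards [(isClosed_tsupport χ).isOpen_compl.mem_nhds h1] with q hq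
      simp [b, image_eq_zero_of_notMem_tsupport hq]
    rw [χ.tsupport_eq] at h1
    have h2 : p ∈ Metric.ball (0 : E) R := Metric.closedBall_subset_ball (by
      change R / 2 < R; linarith) h1
    exact χ.contDiffAt.smul (hβ p h2)
  have hbβ : ∀ p ∈ Metric.ball (0 : E) (R / 3), b =ᶠ[𝓝 p] β := by
    intro p hp
    filter_upwards [Metric.isOpen_ball.mem_nhds hp] with q hq
    simp only [b]
    rw [χ.one_of_mem_closedBall (Metric.ball_subset_closedBall hq), one_smul]
  have hsub : Metric.ball (0 : E) (R / 3) ⊆ Metric.ball 0 R := Metric.ball_subset_ball (by linarith)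
  have hb0 : ∀ p ∈ Metric.ball (0 : E) (R / 3), ∀ u, b p u = 0 ↔ α (p₀ + p) u = 0 := by
    intro p hp u
    rw [(hbβ p hp).self_of_nhds]
    have := (hRs p (hsub hp)).self_of_nhds.2.2
    simp [β, this]
  obtain ⟨f, hf⟩ := exists_first_integral_normalized hb (e := e) (r := R / 3) (by positivity)
    (fun p hp => by
      rw [(hbβ p hp).self_of_nhds]
      have := (hRs p (hsub hp)).self_of_nhds.2.2
      simp [β, this])
    -- Rescaling α by a function adds to the derivative only terms with a factor α(u) or α(v), which
    -- vanish on the kernel.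
    (fun p hp u v hu hv => by
      obtain ⟨h1, h2, h3⟩ := (hRs p (hsub hp)).self_of_nhds
      rw [hb0 p hp] at hu hv
      have h4 : DifferentiableAt ℝ (fun p => α (p₀ + p)) p :=
        (ContDiffAt.comp p h1 (contDiffAt_const.add contDiffAt_id)).differentiableAt
          (by simp)
      have h5 : DifferentiableAt ℝ (fun p => (α (p₀ + p) e)⁻¹) p :=
        (h4.clm_apply (differentiableAt_const e)).inv h3
      have h6 : fderiv ℝ b p = _ := (hbβ p hp).fderiv_eq.trans (fderiv_fun_smul h5 h4)
      rw [h6]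
      have h7 : fderiv ℝ (fun p => α (p₀ + p)) p = fderiv ℝ α (p₀ + p) := by
        rw [fderiv_comp_add_left]
      simp [h7, hu, hv, h2 u v hu hv])
  have htr' : Tendsto (fun p : E => p - p₀) (𝓝 p₀) (𝓝 0) := by
    have : ContinuousAt (fun p : E => p - p₀) p₀ := by fun_prop
    simpa [ContinuousAt] using this
  refine ⟨fun p => f (p - p₀), ?_⟩
  filter_upwards [htr'.eventually hf,
    htr'.eventually (Metric.ball_mem_nhds (0 : E) (show 0 < R / 3 by positivity))] with p hp hp'
  obtain ⟨h1, h2, h3⟩ := hp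
  have h4 : fderiv ℝ (fun p => f (p - p₀)) p = fderiv ℝ f (p - p₀) := by
    rw [fderiv_comp_sub]
  refine ⟨ContDiffAt.comp p h1 (contDiffAt_id.sub contDiffAt_const), by rwa [h4], fun u => ?_⟩
  rw [h4, h3, hb0 _ hp', add_sub_cancel]

end Frobenius

/-! ### Vector fields, 1-forms and Lie brackets in charts. -/

section Charts

variable {m : ℕ} {M : Type*} [TopologicalSpace M] [ChartedSpace (EuclideanSpace ℝ (Fin m)) M]

/-- The differential of a chart at a point, with values in the model space. -/
def chartDeriv (φ : OpenPartialHomeomorph M (EuclideanSpace ℝ (Fin m))) (y : M) :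
    TangentSpace (𝓡 m) y →L[ℝ] EuclideanSpace ℝ (Fin m) :=
  mfderiv (𝓡 m) (𝓡 m) φ y

/-- The expression of a vector field in a chart. -/
def chartField (φ : OpenPartialHomeomorph M (EuclideanSpace ℝ (Fin m)))
    (X : ∀ x : M, TangentSpace (𝓡 m) x) (p : EuclideanSpace ℝ (Fin m)) :
    EuclideanSpace ℝ (Fin m) :=
  chartDeriv φ (φ.symm p) (X (φ.symm p))

/-- The vector field with a given expression in a chart. -/
def fieldOfChart (φ : OpenPartialHomeomorph M (EuclideanSpace ℝ (Fin m)))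
    (V : EuclideanSpace ℝ (Fin m) → EuclideanSpace ℝ (Fin m)) (x : M) : TangentSpace (𝓡 m) x :=
  (chartDeriv φ x).inverse (V (φ x))

/-- The expression of a 1-form in a chart. -/
def chartForm (φ : OpenPartialHomeomorph M (EuclideanSpace ℝ (Fin m)))
    (α : ∀ x : M, Module.Dual ℝ (TangentSpace (𝓡 m) x)) (p : EuclideanSpace ℝ (Fin m)) :
    EuclideanSpace ℝ (Fin m) →L[ℝ] ℝ :=
  LinearMap.toContinuousLinearMap ((α (φ.symm p)).comp (chartDeriv φ (φ.symm p)).inverse.toLinearMap)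

variable {φ : OpenPartialHomeomorph M (EuclideanSpace ℝ (Fin m))}

omit [ChartedSpace (EuclideanSpace ℝ (Fin m)) M] in
lemma eventually_chart {φ : OpenPartialHomeomorph M (EuclideanSpace ℝ (Fin m))} {x : M}
    (hx : x ∈ φ.source) {P : M → Prop} (h : ∀ᶠ y in 𝓝 x, P y) :
    ∀ᶠ p in 𝓝 (φ x), p ∈ φ.target ∧ P (φ.symm p) := by
  have ht := φ.map_source hx
  have hc : Tendsto φ.symm (𝓝 (φ x)) (𝓝 x) := by
    have := φ.continuousAt_symm ht
    rwa [ContinuousAt, φ.left_inv hx] at this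
  exact (φ.open_target.eventually_mem ht).and (hc.eventually h)

lemma chartField_apply (X : ∀ x : M, TangentSpace (𝓡 m) x) {y : M} (hy : y ∈ φ.source) :
    chartField φ X (φ y) = chartDeriv φ y (X y) := by
  -- The tangent space depends on the base point, so φ.symm (φ y) = y is used by substitution and
  -- not by rewriting.
  have : ∀ y', y' = y → chartDeriv φ y' (X y') = chartDeriv φ y (X y) := by rintro _ rfl; rfl
  exact this _ (φ.left_inv hy)

lemma chartForm_apply (α : ∀ x : M, Module.Dual ℝ (TangentSpace (𝓡 m) x)) {y : M}
    (hy : y ∈ φ.source) (u : EuclideanSpace ℝ (Fin m)) :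
    chartForm φ α (φ y) u = α y ((chartDeriv φ y).inverse u) := by
  have : ∀ y', y' = y → α y' ((chartDeriv φ y').inverse u) = α y ((chartDeriv φ y).inverse u) := by
    rintro _ rfl; rfl
  exact this _ (φ.left_inv hy)

lemma mdifferentiable_of_mem_maximalAtlas (hφ : φ ∈ IsManifold.maximalAtlas (𝓡 m) ∞ M) :
    φ.MDifferentiable (𝓡 m) (𝓡 m) :=
  ⟨(contMDiffOn_of_mem_maximalAtlas hφ).mdifferentiableOn (by simp),
    (contMDiffOn_symm_of_mem_maximalAtlas hφ).mdifferentiableOn (by simp)⟩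

lemma isInvertible_chartDeriv (hφ : φ ∈ IsManifold.maximalAtlas (𝓡 m) ∞ M) {y : M}
    (hy : y ∈ φ.source) : (chartDeriv φ y).IsInvertible :=
  ⟨(mdifferentiable_of_mem_maximalAtlas hφ).mfderiv hy, rfl⟩

lemma inverse_mfderiv_symm (hφ : φ ∈ IsManifold.maximalAtlas (𝓡 m) ∞ M)
    {p : EuclideanSpace ℝ (Fin m)} (hp : p ∈ φ.target) :
    (mfderiv (𝓡 m) (𝓡 m) φ.symm p).inverse = chartDeriv φ (φ.symm p) ∧
      (mfderiv (𝓡 m) (𝓡 m) φ.symm p).IsInvertible := by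
  have hd := mdifferentiable_of_mem_maximalAtlas hφ
  have h1 := hd.comp_symm_deriv hp
  have h2 : (mfderiv (𝓡 m) (𝓡 m) φ.symm p).comp (mfderiv (𝓡 m) (𝓡 m) φ (φ.symm p)) =
      ContinuousLinearMap.id ℝ (TangentSpace (𝓡 m) (φ.symm p)) := by
    have := hd.symm_comp_deriv (φ.map_target hp)
    rwa [φ.right_inv hp] at this
  exact ⟨ContinuousLinearMap.inverse_eq h2 h1, ContinuousLinearMap.IsInvertible.of_inverse h2 h1⟩

lemma fieldOfChart_chartField (hφ : φ ∈ IsManifold.maximalAtlas (𝓡 m) ∞ M)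
    (X : ∀ x : M, TangentSpace (𝓡 m) x) {y : M} (hy : y ∈ φ.source) :
    fieldOfChart φ (chartField φ X) y = X y := by
  rw [fieldOfChart, chartField_apply X hy]
  exact (isInvertible_chartDeriv hφ hy).inverse_apply_self _

lemma contDiffAt_comp_symm {k : ℕ} (hφ : φ ∈ IsManifold.maximalAtlas (𝓡 m) ∞ M)
    {f : M → EuclideanSpace ℝ (Fin k)} {y : M} (hy : y ∈ φ.source)
    (hf : ContMDiffAt (𝓡 m) (𝓡 k) ∞ f y) : ContDiffAt ℝ ∞ (fun p => f (φ.symm p)) (φ y) := by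
  rw [← contMDiffAt_iff_contDiffAt]
  refine ContMDiffAt.comp (φ y) (I' := 𝓡 m) ?_
    (contMDiffAt_symm_of_mem_maximalAtlas hφ (φ.map_source hy))
  rwa [φ.left_inv hy]

lemma mfderiv_eq_fderiv_chart {k : ℕ} (hφ : φ ∈ IsManifold.maximalAtlas (𝓡 m) ∞ M)
    {f : M → EuclideanSpace ℝ (Fin k)} {y : M} (hy : y ∈ φ.source)
    (hf : ContMDiffAt (𝓡 m) (𝓡 k) ∞ f y) (v : TangentSpace (𝓡 m) y) :
    mfderiv (𝓡 m) (𝓡 k) f y v = fderiv ℝ (fun p => f (φ.symm p)) (φ y) (chartDeriv φ y v) := by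
  have h1 : MDifferentiableAt (𝓡 m) (𝓡 k) (fun p => f (φ.symm p)) (φ y) :=
    (contDiffAt_comp_symm hφ hy hf).contMDiffAt.mdifferentiableAt (by simp)
  have h2 : MDifferentiableAt (𝓡 m) (𝓡 m) φ y :=
    (mdifferentiable_of_mem_maximalAtlas hφ).mdifferentiableAt hy
  have h3 := mfderiv_comp y h1 h2
  have h4 : mfderiv (𝓡 m) (𝓡 k) ((fun p => f (φ.symm p)) ∘ φ) y = mfderiv (𝓡 m) (𝓡 k) f y := by
    apply Filter.EventuallyEq.mfderiv_eq
    filter_upwards [φ.open_source.mem_nhds hy] with z hz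
    simp [φ.left_inv hz]
  rw [← h4, h3, ← mfderiv_eq_fderiv]
  rfl

variable [IsManifold (𝓡 m) ∞ M]

lemma contMDiffAt_fieldOfChart (hφ : φ ∈ IsManifold.maximalAtlas (𝓡 m) ∞ M)
    {V : EuclideanSpace ℝ (Fin m) → EuclideanSpace ℝ (Fin m)} {y : M} (hy : y ∈ φ.source)
    (hV : ContDiffAt ℝ ∞ V (φ y)) :
    ContMDiffAt (𝓡 m) (𝓡 m).tangent ∞
      (fun x => (⟨x, fieldOfChart φ V x⟩ : TangentBundle (𝓡 m) M)) y := by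
  have : IsManifold (𝓡 m) 1 M := IsManifold.of_le (n := ∞) (by simp)
  have hV' := contMDiffAt_vectorSpace_iff_contDiffAt.2 hV
  exact ContMDiffAt.mpullback_vectorField_preimage (n := ∞) hV'
    (contMDiffAt_of_mem_maximalAtlas hφ hy) (isInvertible_chartDeriv hφ hy) (by simp)

lemma contDiffAt_chartField (hφ : φ ∈ IsManifold.maximalAtlas (𝓡 m) ∞ M)
    {X : ∀ x : M, TangentSpace (𝓡 m) x} {y : M} (hy : y ∈ φ.source)
    (hX : ContMDiffAt (𝓡 m) (𝓡 m).tangent ∞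
      (fun x => (⟨x, X x⟩ : TangentBundle (𝓡 m) M)) y) :
    ContDiffAt ℝ ∞ (chartField φ X) (φ y) := by
  have : IsManifold (𝓡 m) 1 M := IsManifold.of_le (n := ∞) (by simp)
  have ht : φ y ∈ φ.target := φ.map_source hy
  have h1 := ContMDiffAt.mpullback_vectorField_preimage (n := ∞) (m := ∞) (x₀ := φ y)
    (I := 𝓡 m) (V := X) (f := φ.symm)
    (by rw [φ.left_inv hy]; exact hX)
    (contMDiffAt_symm_of_mem_maximalAtlas hφ ht) (inverse_mfderiv_symm hφ ht).2 (by simp)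
  have h2 := contMDiffAt_vectorSpace_iff_contDiffAt.1 h1
  refine h2.congr_of_eventuallyEq ?_
  filter_upwards [φ.open_target.mem_nhds ht] with p hp
  rw [VectorField.mpullback_apply, (inverse_mfderiv_symm hφ hp).1]
  rfl

lemma SmoothFieldOn.contMDiffAt {X : ∀ x : M, TangentSpace (𝓡 m) x} {U : Set M}
    (hX : SmoothFieldOn X U) (hU : IsOpen U) {y : M} (hy : y ∈ U) :
    ContMDiffAt (𝓡 m) (𝓡 m).tangent ∞ (fun x => (⟨x, X x⟩ : TangentBundle (𝓡 m) M)) y :=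
  ContMDiffOn.contMDiffAt hX (hU.mem_nhds hy)

lemma SmoothFieldOn.contDiffAt_chartField (hφ : φ ∈ IsManifold.maximalAtlas (𝓡 m) ∞ M)
    {X : ∀ x : M, TangentSpace (𝓡 m) x} {U : Set M}
    (hX : SmoothFieldOn X U) (hU : IsOpen U) {y : M} (hy : y ∈ U) (hyφ : y ∈ φ.source) :
    ContDiffAt ℝ ∞ (chartField φ X) (φ y) :=
  VeroneseWebs.contDiffAt_chartField hφ hyφ (hX.contMDiffAt hU hy)

/-- A vector field whose expressions in charts are smooth is smooth. -/
lemma smoothFieldOn_of_chartField {X : ∀ x : M, TangentSpace (𝓡 m) x} {U : Set M}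
    (h : ∀ y ∈ U, ∃ φ ∈ IsManifold.maximalAtlas (𝓡 m) ∞ M, y ∈ φ.source ∧
      ContDiffAt ℝ ∞ (chartField φ X) (φ y)) : SmoothFieldOn X U := by
  intro y hy
  obtain ⟨φ, hφ, hyφ, hc⟩ := h y hy
  refine ((contMDiffAt_fieldOfChart hφ hyφ hc).congr_of_eventuallyEq ?_).contMDiffWithinAt
  filter_upwards [φ.open_source.mem_nhds hyφ] with z hz
  rw [fieldOfChart_chartField hφ X hz]

/-- The Lie bracket in a chart. -/
lemma chartDeriv_mlieBracket (hφ : φ ∈ IsManifold.maximalAtlas (𝓡 m) ∞ M)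
    {X Y : ∀ x : M, TangentSpace (𝓡 m) x} {y : M} (hy : y ∈ φ.source)
    (hX : ContDiffAt ℝ ∞ (chartField φ X) (φ y)) (hY : ContDiffAt ℝ ∞ (chartField φ Y) (φ y)) :
    chartDeriv φ y (VectorField.mlieBracket (𝓡 m) X Y y) =
      VectorField.lieBracket ℝ (chartField φ X) (chartField φ Y) (φ y) := by
  have hle : minSmoothness ℝ 2 ≤ ∞ := by
    rw [minSmoothness_of_isRCLikeNormedField]
    exact WithTop.coe_le_coe.2 (le_top : (2 : ℕ∞) ≤ ⊤)
  have : IsManifold (𝓡 m) (minSmoothness ℝ 2) M := IsManifold.of_le (n := ∞) hle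
  have hmd : ∀ {V : EuclideanSpace ℝ (Fin m) → EuclideanSpace ℝ (Fin m)}, ContDiffAt ℝ ∞ V (φ y) →
      MDifferentiableAt (𝓡 m) (𝓡 m).tangent
        (fun p => (⟨p, V p⟩ : TangentBundle (𝓡 m) (EuclideanSpace ℝ (Fin m)))) (φ y) := fun h =>
    (contMDiffAt_vectorSpace_iff_contDiffAt.2 h).mdifferentiableAt (by simp)
  -- Near y each field is the pullback by φ of its chart expression, and brackets commute with
  -- pullback.
  have h1 := VectorField.mpullback_mlieBracket (I := 𝓡 m) (n := ∞) (x₀ := y) (hmd hX) (hmd hY)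
    (contMDiffAt_of_mem_maximalAtlas hφ hy) hle
  have hev : ∀ X : ∀ x : M, TangentSpace (𝓡 m) x,
      X =ᶠ[𝓝 y] VectorField.mpullback (𝓡 m) (𝓡 m) φ (chartField φ X) := by
    intro X
    filter_upwards [φ.open_source.mem_nhds hy] with z hz
    exact (fieldOfChart_chartField hφ X hz).symm
  rw [(hev X).mlieBracket_vectorField_eq (hev Y), ← h1]
  have h2 := (isInvertible_chartDeriv hφ hy).self_apply_inverse
    (VectorField.mlieBracket (𝓡 m) (chartField φ X) (chartField φ Y) (φ y))
  refine h2.trans ((congrFun (VectorField.mlieBracketWithin_eq_lieBracketWithin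
    (V := chartField φ X) (W := chartField φ Y) (s := univ)) (φ y)).trans ?_)
  rw [VectorField.lieBracketWithin_univ]

lemma smoothOneFormOn_of_chartForm {α : ∀ x : M, Module.Dual ℝ (TangentSpace (𝓡 m) x)} {U : Set M}
    (h : ∀ y ∈ U, ∃ φ ∈ IsManifold.maximalAtlas (𝓡 m) ∞ M, y ∈ φ.source ∧
      ContDiffAt ℝ ∞ (chartForm φ α) (φ y)) : SmoothOneFormOn α U := by
  intro V hV hVU X hX y hy
  obtain ⟨φ, hφ, hyφ, hc⟩ := h y (hVU hy)
  have h1 : ContDiffAt ℝ ∞ (fun p => chartForm φ α p (chartField φ X p)) (φ y) :=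
    hc.clm_apply (hX.contDiffAt_chartField hφ hV hy hyφ)
  have h2 : ContMDiffAt (𝓡 m) 𝓘(ℝ) ∞
      ((fun p => chartForm φ α p (chartField φ X p)) ∘ φ) y :=
    h1.contMDiffAt.comp y (contMDiffAt_of_mem_maximalAtlas hφ hyφ)
  refine (h2.congr_of_eventuallyEq ?_).contMDiffWithinAt
  filter_upwards [φ.open_source.mem_nhds hyφ] with z hz
  rw [Function.comp_apply, chartForm_apply α hz, chartField_apply X hz,
    (isInvertible_chartDeriv hφ hz).inverse_apply_self]

lemma SmoothOneFormOn.contDiffAt_chartForm (hφ : φ ∈ IsManifold.maximalAtlas (𝓡 m) ∞ M)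
    {α : ∀ x : M, Module.Dual ℝ (TangentSpace (𝓡 m) x)} {U : Set M} (hU : IsOpen U)
    (hα : SmoothOneFormOn α U) {y : M} (hy : y ∈ U) (hyφ : y ∈ φ.source) :
    ContDiffAt ℝ ∞ (chartForm φ α) (φ y) := by
  have hW : IsOpen (φ.target ∩ φ.symm ⁻¹' U) := φ.isOpen_inter_preimage_symm hU
  have hyW : φ y ∈ φ.target ∩ φ.symm ⁻¹' U :=
    ⟨φ.map_source hyφ, by rwa [mem_preimage, φ.left_inv hyφ]⟩
  refine ContDiffOn.contDiffAt (s := φ.target ∩ φ.symm ⁻¹' U) ?_ (hW.mem_nhds hyW)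
  rw [contDiffOn_clm_apply]
  intro u p hp
  -- In finite dimension it is enough to test the form on fields that are constant in the chart.
  have hX : SmoothFieldOn (fieldOfChart φ fun _ => u) (U ∩ φ.source) := fun z hz =>
    (contMDiffAt_fieldOfChart hφ hz.2 contDiffAt_const).contMDiffWithinAt
  have h1 := hα _ (hU.inter φ.open_source) inter_subset_left _ hX
  have h2 := (h1.contMDiffAt ((hU.inter φ.open_source).mem_nhds ⟨hp.2, φ.map_target hp.1⟩)).comp p
    (contMDiffAt_symm_of_mem_maximalAtlas hφ hp.1)
  exact h2.contDiffAt.contDiffWithinAt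

end Charts

/-! ### Brackets and forms on a normed space. -/

section Calculus

variable {E G : Type*} [NormedAddCommGroup E] [NormedSpace ℝ E]
  [NormedAddCommGroup G] [NormedSpace ℝ G]

/-- The value of a 1-form on the bracket of two fields in its kernel. -/
lemma apply_lieBracket_of_ker {α : E → E →L[ℝ] G} {X Y : E → E} {p : E}
    (hα : DifferentiableAt ℝ α p) (hX : DifferentiableAt ℝ X p) (hY : DifferentiableAt ℝ Y p)
    (hαX : ∀ᶠ q in 𝓝 p, α q (X q) = 0) (hαY : ∀ᶠ q in 𝓝 p, α q (Y q) = 0) :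
    α p (VectorField.lieBracket ℝ X Y p) =
      fderiv ℝ α p (Y p) (X p) - fderiv ℝ α p (X p) (Y p) := by
  -- Leibniz rule applied to the identity α(Z) = 0.
  have key : ∀ Z : E → E, DifferentiableAt ℝ Z p → (∀ᶠ q in 𝓝 p, α q (Z q) = 0) → ∀ u,
      α p (fderiv ℝ Z p u) = - fderiv ℝ α p u (Z p) := by
    intro Z hZ h0 u
    have h1 := hα.hasFDerivAt.clm_apply hZ.hasFDerivAt
    have h2 : HasFDerivAt (fun q => α q (Z q)) (0 : E →L[ℝ] G) p :=
      (hasFDerivAt_const (0 : G) p).congr_of_eventuallyEq h0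
    have h3 := congrArg (fun A => A u) (h1.unique h2)
    simp only [add_apply, ContinuousLinearMap.comp_apply, ContinuousLinearMap.flip_apply,
      zero_apply] at h3
    exact eq_neg_of_add_eq_zero_left h3
  rw [VectorField.lieBracket, map_sub, key Y hY hαY, key X hX hαX]
  abel

/-- The Nijenhuis torsion of a constant operator vanishes. -/
lemma lieBracket_const_operator (A : E →L[ℝ] E) {X Y : E → E} {p : E}
    (hX : DifferentiableAt ℝ X p) (hY : DifferentiableAt ℝ Y p) :
    VectorField.lieBracket ℝ (fun q => A (X q)) (fun q => A (Y q)) p =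
      A (VectorField.lieBracket ℝ (fun q => A (X q)) Y p
        + VectorField.lieBracket ℝ X (fun q => A (Y q)) p
        - A (VectorField.lieBracket ℝ X Y p)) := by
  have h1 : ∀ Z : E → E, DifferentiableAt ℝ Z p →
      fderiv ℝ (fun q => A (Z q)) p = A.comp (fderiv ℝ Z p) := fun Z hZ =>
    (A.hasFDerivAt.comp p hZ.hasFDerivAt).fderiv
  simp only [VectorField.lieBracket, h1 X hX, h1 Y hY, ContinuousLinearMap.comp_apply, map_sub,
    map_add]
  abel

end Calculus

/-! ### Involutivity of foliations. -/

section Involutive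

variable {m : ℕ} {M : Type*} [TopologicalSpace M] [ChartedSpace (EuclideanSpace ℝ (Fin m)) M]
  [IsManifold (𝓡 m) ∞ M]

/-- The tangent distribution of a foliation is involutive. -/
theorem Foliation.mlieBracket_mem {q : ℕ} (F : Foliation m M q) {U : Set M} (hU : IsOpen U)
    {X Y : ∀ x : M, TangentSpace (𝓡 m) x} (hX : F.IsSectionOn X U) (hY : F.IsSectionOn Y U)
    {x : M} (hx : x ∈ U) : VectorField.mlieBracket (𝓡 m) X Y x ∈ F.T x := by
  obtain ⟨V, hV, hxV, f, hf, hT⟩ := F.exists_submersion x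
  let φ := chartAt (EuclideanSpace ℝ (Fin m)) x
  have hφ : φ ∈ IsManifold.maximalAtlas (𝓡 m) ∞ M := IsManifold.chart_mem_maximalAtlas x
  have hxφ : x ∈ φ.source := mem_chart_source _ x
  let g : EuclideanSpace ℝ (Fin m) → EuclideanSpace ℝ (Fin q) := fun p => f (φ.symm p)
  have hfat : ∀ y ∈ V, ContMDiffAt (𝓡 m) (𝓡 q) ∞ f y := fun y hy => hf.contMDiffAt (hV.mem_nhds hy)
  have hg : ContDiffAt ℝ ∞ g (φ x) := contDiffAt_comp_symm hφ hxφ (hfat x hxV)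
  have hker : ∀ Z : ∀ x : M, TangentSpace (𝓡 m) x, F.IsSectionOn Z U →
      ∀ᶠ p in 𝓝 (φ x), fderiv ℝ g p (chartField φ Z p) = 0 := by
    intro Z hZ
    have hUV : ∀ᶠ y in 𝓝 x, y ∈ U ∩ V := (hU.inter hV).mem_nhds ⟨hx, hxV⟩
    filter_upwards [eventually_chart hxφ hUV] with p hp
    have h1 := hZ.2 _ hp.2.1
    rw [(hT _ hp.2.2).2, LinearMap.mem_ker] at h1
    have h2 := mfderiv_eq_fderiv_chart hφ (φ.map_target hp.1) (hfat _ hp.2.2) (Z (φ.symm p))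
    rw [φ.right_inv hp.1] at h2
    exact h2.symm.trans h1
  have hXd := hX.1.contDiffAt_chartField hφ hU hx hxφ
  have hYd := hY.1.contDiffAt_chartField hφ hU hx hxφ
  have hg' : ContDiffAt ℝ 1 (fderiv ℝ g) (φ x) :=
    hg.fderiv_right (by exact WithTop.coe_le_coe.2 (le_top : (2 : ℕ∞) ≤ ⊤))
  -- With α = dg, the right-hand side is the antisymmetrised second derivative of g, hence zero.
  have hbr := apply_lieBracket_of_ker (hg'.differentiableAt (by simp))
    (hXd.differentiableAt (by simp)) (hYd.differentiableAt (by simp)) (hker X hX) (hker Y hY)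
  have hsymm : IsSymmSndFDerivAt ℝ g (φ x) := hg.isSymmSndFDerivAt (by
    rw [minSmoothness_of_isRCLikeNormedField]
    exact WithTop.coe_le_coe.2 (le_top : (2 : ℕ∞) ≤ ⊤))
  rw [hsymm.eq, sub_self, ← chartDeriv_mlieBracket hφ hxφ hXd hYd] at hbr
  rw [(hT x hxV).2, LinearMap.mem_ker]
  exact (mfderiv_eq_fderiv_chart hφ hxφ (hfat x hxV) _).trans hbr

end Involutive

/-! ### Linear algebra of a Kronecker block and of the Veronese curve. -/

section LinearAlgebra

variable {n : ℕ} {V : Type*} [AddCommGroup V] [Module ℝ V]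

/-- `α` and `X` are dual bases. -/
structure IsDualFrame (α : Fin (n + 1) → Module.Dual ℝ V) (X : Fin (n + 1) → V) : Prop where
  pairing : ∀ i j, α i (X j) = if i = j then 1 else 0
  expansion : ∀ v, ∑ i, α i v • X i = v

lemma veroneseCurve_infty (α : Fin (n + 1) → V) :
    veroneseCurve α OnePoint.infty = α (Fin.last n) := rfl

lemma veroneseCurve_coe (α : Fin (n + 1) → V) (c : ℝ) :
    veroneseCurve α (c : OnePoint ℝ) = ∑ i : Fin (n + 1), c ^ (i : ℕ) • α i := rfl

lemma veroneseCurve_apply (α : Fin (n + 1) → Module.Dual ℝ V) (c : ℝ) (v : V) :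
    veroneseCurve α (c : OnePoint ℝ) v = ∑ i : Fin (n + 1), c ^ (i : ℕ) * α i v := by
  rw [veroneseCurve_coe]
  simp

namespace IsDualFrame

variable {α : Fin (n + 1) → Module.Dual ℝ V} {X : Fin (n + 1) → V} (h : IsDualFrame α X)
include h

lemma ext {u v : V} (huv : ∀ i, α i u = α i v) : u = v := by
  rw [← h.expansion u, ← h.expansion v]
  simp [huv]

lemma linearIndependent : LinearIndependent ℝ X := by
  rw [Fintype.linearIndependent_iff]
  intro g hg i
  have := congrArg (α i) hg
  simpa [h.pairing] using this

lemma span_eq_top : Submodule.span ℝ (range X) = ⊤ := by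
  rw [eq_top_iff]
  intro v _
  rw [← h.expansion v]
  exact Submodule.sum_mem _ fun i _ =>
    Submodule.smul_mem _ _ (Submodule.subset_span (mem_range_self i))

lemma linearIndependent_dual : LinearIndependent ℝ α := by
  rw [Fintype.linearIndependent_iff]
  intro g hg i
  have := congrArg (fun a => a (X i)) hg
  simpa [h.pairing] using this

lemma finiteDimensional : FiniteDimensional ℝ V :=
  (Module.Basis.mk h.linearIndependent h.span_eq_top.ge).finiteDimensional_of_finite

lemma veroneseCurve_ne_zero (c : OnePoint ℝ) : veroneseCurve α c ≠ 0 := by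
  intro h0
  induction c using OnePoint.rec with
  | infty =>
    have := congrArg (fun a => a (X (Fin.last n))) h0
    simp [veroneseCurve_infty, h.pairing] at this
  | coe c =>
    have := congrArg (fun a => a (X 0)) h0
    simp [veroneseCurve_coe, h.pairing] at this

/-- Points of the Veronese curve at distinct parameters have no common zero. -/
lemma eq_zero_of_veroneseCurve {l : Fin (n + 1) → ℝ} (hl : Function.Injective l) {v : V}
    (hv : ∀ i, veroneseCurve α (l i : OnePoint ℝ) v = 0) : v = 0 := by
  -- The coordinates of v are annihilated by a Vandermonde matrix with distinct nodes.
  have h1 : (fun i => α i v) = 0 :=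
    Matrix.eq_zero_of_forall_index_sum_pow_mul_eq_zero hl fun j => by
      rw [← hv j, veroneseCurve_apply]
  exact h.ext fun i => by simpa using congrFun h1 i

section Shift

variable {T : Submodule ℝ V} (hT : T = LinearMap.ker (α (Fin.last n))) {J : T →ₗ[ℝ] V}
include hT

lemma mem_castSucc (k : Fin n) : X k.castSucc ∈ T := by
  rw [hT, LinearMap.mem_ker, h.pairing, if_neg (Fin.castSucc_lt_last k).ne']

lemma span_castSucc : Submodule.span ℝ (range fun k : Fin n => X k.castSucc) = T := by
  apply le_antisymm
  · rw [Submodule.span_le]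
    rintro _ ⟨k, rfl⟩
    exact h.mem_castSucc hT k
  · intro v hv
    rw [hT, LinearMap.mem_ker] at hv
    rw [← h.expansion v, Fin.sum_univ_castSucc, hv, zero_smul, add_zero]
    exact Submodule.sum_mem _ fun i _ =>
      Submodule.smul_mem _ _ (Submodule.subset_span (mem_range_self i))

variable (hJ : ∀ k : Fin n, J ⟨X k.castSucc, h.mem_castSucc hT k⟩ = X k.succ)
include hJ

lemma shift_apply (v : T) : J v = ∑ k : Fin n, α k.castSucc v • X k.succ := by
  have hv : v = ∑ k : Fin n, α k.castSucc v • (⟨X k.castSucc, h.mem_castSucc hT k⟩ : T) := by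
    have h0 : α (Fin.last n) v = 0 := hT.le v.2
    ext
    conv_lhs => rw [← h.expansion (v : V), Fin.sum_univ_castSucc, h0, zero_smul, add_zero]
    simp
  conv_lhs => rw [hv]
  rw [map_sum]
  exact Finset.sum_congr rfl fun k _ => by rw [map_smul, hJ]

lemma coord_succ_shift (v : T) (k : Fin n) : α k.succ (J v) = α k.castSucc v := by
  rw [h.shift_apply hT hJ]
  simp [h.pairing]

lemma coord_zero_shift (v : T) : α 0 (J v) = 0 := by
  rw [h.shift_apply hT hJ]
  simp [h.pairing, (Fin.succ_ne_zero _).symm]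

/-- Shifting the index multiplies each power of c by c. No boundary term appears, since α_0 vanishes
on the image of J and α_n vanishes on T. -/
lemma veroneseCurve_shift (c : ℝ) (v : T) :
    veroneseCurve α (c : OnePoint ℝ) (J v) = c * veroneseCurve α (c : OnePoint ℝ) (v : V) := by
  have h0 : α (Fin.last n) v = 0 := hT.le v.2
  rw [veroneseCurve_apply, veroneseCurve_apply, Fin.sum_univ_succ, Fin.sum_univ_castSucc,
    h.coord_zero_shift hT hJ, h0, mul_zero, mul_zero, zero_add, add_zero, Finset.mul_sum]
  refine Finset.sum_congr rfl fun k _ => ?_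
  rw [h.coord_succ_shift hT hJ, Fin.val_succ, Fin.val_castSucc, pow_succ]
  ring

/-- If Jv = cv, then α_k(v) = α_{k+1}(Jv) = c α_{k+1}(v). Descending from α_n(v) = 0, all
coordinates vanish. -/
lemma shift_sub_injective (c : ℝ) : Function.Injective (J - c • T.subtype) := by
  rw [← LinearMap.ker_eq_bot, LinearMap.ker_eq_bot']
  intro v hv
  have hv' : J v = c • (v : V) := sub_eq_zero.1 hv
  have hlast : α (Fin.last n) v = 0 := hT.le v.2
  have hall : ∀ i : Fin (n + 1), α i v = 0 := by
    intro i
    induction i using Fin.reverseInduction with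
    | last => exact hlast
    | cast k ih =>
      rw [← h.coord_succ_shift hT hJ, hv', map_smul, ih, smul_zero]
  ext
  exact h.ext fun i => by simp [hall]

/-- The image of a shifted Kronecker block is the kernel of the Veronese curve. -/
theorem range_shift (c : ℝ) :
    LinearMap.range (J - c • T.subtype) = LinearMap.ker (veroneseCurve α (c : OnePoint ℝ)) := by
  have := h.finiteDimensional
  apply Submodule.eq_of_le_of_finrank_eq
  · rintro _ ⟨v, rfl⟩
    simp [h.veroneseCurve_shift hT hJ]
  · rw [LinearMap.finrank_range_of_inj (h.shift_sub_injective hT hJ c), hT]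
    have h1 := Module.Dual.finrank_ker_add_one_of_ne_zero
      (h.veroneseCurve_ne_zero (c : OnePoint ℝ))
    have h2 := Module.Dual.finrank_ker_add_one_of_ne_zero
      (h.veroneseCurve_ne_zero OnePoint.infty)
    rw [veroneseCurve_infty] at h2
    omega

end Shift

lemma exists_shift {T : Submodule ℝ V} (hT : T = LinearMap.ker (α (Fin.last n))) :
    ∃ J : T →ₗ[ℝ] V, ∀ k : Fin n, J ⟨X k.castSucc, h.mem_castSucc hT k⟩ = X k.succ := by
  refine ⟨(∑ k : Fin n, (α k.castSucc).smulRight (X k.succ)).comp T.subtype, fun k => ?_⟩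
  simp [h.pairing]

/-- A partial operator is determined by the images of its shifts. -/
lemma operator_unique {T : Submodule ℝ V} {J J' : T →ₗ[ℝ] V}
    (hJ : ∀ c : ℝ, LinearMap.range (J - c • T.subtype) ≤
      LinearMap.ker (veroneseCurve α (c : OnePoint ℝ)))
    (hJ' : ∀ c : ℝ, LinearMap.range (J' - c • T.subtype) ≤
      LinearMap.ker (veroneseCurve α (c : OnePoint ℝ))) : J = J' := by
  ext v
  -- Any n+1 distinct parameters would do; 0, …, n are convenient.
  have hl : Function.Injective (fun i : Fin (n + 1) => ((i : ℕ) : ℝ)) := fun i j hij => by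
    simpa [Fin.ext_iff] using hij
  rw [← sub_eq_zero]
  refine h.eq_zero_of_veroneseCurve hl fun i => ?_
  have h1 : veroneseCurve α (((i : ℕ) : ℝ) : OnePoint ℝ) _ = 0 := hJ (i : ℕ) ⟨v, rfl⟩
  have h2 : veroneseCurve α (((i : ℕ) : ℝ) : OnePoint ℝ) _ = 0 := hJ' (i : ℕ) ⟨v, rfl⟩
  have h3 : J v - J' v = (J - ((i : ℕ) : ℝ) • T.subtype) v - (J' - ((i : ℕ) : ℝ) • T.subtype) v := by
    simp
  rw [h3, map_sub, h1, h2, sub_zero]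

end IsDualFrame

lemma dualCoannihilator_span_singleton (a : Module.Dual ℝ V) :
    (Submodule.span ℝ {a}).dualCoannihilator = LinearMap.ker a := by
  ext v
  rw [Submodule.mem_dualCoannihilator, LinearMap.mem_ker]
  refine ⟨fun h => h a (Submodule.mem_span_singleton_self a), fun h b hb => ?_⟩
  obtain ⟨r, rfl⟩ := Submodule.mem_span_singleton.1 hb
  simp [h]

lemma eq_ker_of_dualAnnihilator_eq [FiniteDimensional ℝ V] {T : Submodule ℝ V}
    {a : Module.Dual ℝ V} (h : T.dualAnnihilator = Submodule.span ℝ {a}) :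
    T = LinearMap.ker a := by
  rw [← Subspace.dualAnnihilator_dualCoannihilator_eq (W := T), h, dualCoannihilator_span_singleton]

lemma dualAnnihilator_ker_eq_span [FiniteDimensional ℝ V] (a : Module.Dual ℝ V) :
    (LinearMap.ker a).dualAnnihilator = Submodule.span ℝ {a} := by
  rw [← dualCoannihilator_span_singleton, Subspace.dualCoannihilator_dualAnnihilator_eq]

end LinearAlgebra

/-! ### Smooth frames and their dual coframes. -/

section DualFrames

variable {n : ℕ} {M : Type*} [TopologicalSpace M]
  [ChartedSpace (EuclideanSpace ℝ (Fin (n + 1))) M]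

lemma finrank_tangentSpace (y : M) :
    Module.finrank ℝ (TangentSpace (𝓡 (n + 1)) y) = n + 1 := by
  change Module.finrank ℝ (EuclideanSpace ℝ (Fin (n + 1))) = n + 1
  simp

instance finiteDimensional_tangentSpace (y : M) :
    FiniteDimensional ℝ (TangentSpace (𝓡 (n + 1)) y) :=
  inferInstanceAs (FiniteDimensional ℝ (EuclideanSpace ℝ (Fin (n + 1))))

/-- The 1-form with a given expression in a chart. -/
def formOfChart (φ : OpenPartialHomeomorph M (EuclideanSpace ℝ (Fin (n + 1))))
    (b : EuclideanSpace ℝ (Fin (n + 1)) → EuclideanSpace ℝ (Fin (n + 1)) →L[ℝ] ℝ) (y : M) :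
    Module.Dual ℝ (TangentSpace (𝓡 (n + 1)) y) :=
  ((b (φ y)).comp (chartDeriv φ y)).toLinearMap

/-- The linear map sending the standard basis to the frame `w`. -/
def frameMap {k : ℕ} (w : Fin k → EuclideanSpace ℝ (Fin k)) :
    EuclideanSpace ℝ (Fin k) →L[ℝ] EuclideanSpace ℝ (Fin k) :=
  ∑ i, (EuclideanSpace.proj i : EuclideanSpace ℝ (Fin k) →L[ℝ] ℝ).smulRight (w i)

lemma frameMap_apply {k : ℕ} (w : Fin k → EuclideanSpace ℝ (Fin k))
    (u : EuclideanSpace ℝ (Fin k)) : frameMap w u = ∑ i, u i • w i := by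
  simp [frameMap]

lemma isInvertible_of_injective {k : ℕ}
    {A : EuclideanSpace ℝ (Fin k) →L[ℝ] EuclideanSpace ℝ (Fin k)} (hA : Function.Injective A) :
    A.IsInvertible :=
  ⟨(LinearEquiv.ofInjectiveEndo A.toLinearMap hA).toContinuousLinearEquiv, by ext u; rfl⟩

lemma isInvertible_frameMap {k : ℕ} {w : Fin k → EuclideanSpace ℝ (Fin k)}
    (hw : LinearIndependent ℝ w) : (frameMap w).IsInvertible := by
  refine isInvertible_of_injective ((injective_iff_map_eq_zero _).2 fun u hu => ?_)
  rw [frameMap_apply] at hu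
  ext i
  exact Fintype.linearIndependent_iff.1 hw _ hu i

lemma contDiffAt_frameMap {k : ℕ} {w : Fin k → EuclideanSpace ℝ (Fin k) → EuclideanSpace ℝ (Fin k)}
    {p : EuclideanSpace ℝ (Fin k)} (hw : ∀ i, ContDiffAt ℝ ∞ (w i) p) :
    ContDiffAt ℝ ∞ (fun q => frameMap fun i => w i q) p := by
  unfold frameMap
  refine ContDiffAt.sum fun i _ => ?_
  exact contDiffAt_const.smulRight (hw i)

/-- The linear map whose components are the forms `b`. -/
def coframeMap {k : ℕ} (b : Fin k → EuclideanSpace ℝ (Fin k) →L[ℝ] ℝ) :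
    EuclideanSpace ℝ (Fin k) →L[ℝ] EuclideanSpace ℝ (Fin k) :=
  ∑ i, (b i).smulRight (EuclideanSpace.single i (1 : ℝ))

lemma coframeMap_apply {k : ℕ} (b : Fin k → EuclideanSpace ℝ (Fin k) →L[ℝ] ℝ)
    (u : EuclideanSpace ℝ (Fin k)) (i : Fin k) : coframeMap b u i = b i u := by
  simp [coframeMap, Pi.single_apply]

lemma contDiffAt_coframeMap {k : ℕ}
    {b : Fin k → EuclideanSpace ℝ (Fin k) → EuclideanSpace ℝ (Fin k) →L[ℝ] ℝ}
    {p : EuclideanSpace ℝ (Fin k)} (hb : ∀ i, ContDiffAt ℝ ∞ (b i) p) :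
    ContDiffAt ℝ ∞ (fun q => coframeMap fun i => b i q) p := by
  unfold coframeMap
  exact ContDiffAt.sum fun i _ => (hb i).smulRight contDiffAt_const

variable [IsManifold (𝓡 (n + 1)) ∞ M]

/-- A smooth frame has a smooth dual coframe. -/
lemma exists_dual_coframe {U : Set M} (hU : IsOpen U)
    {X : Fin (n + 1) → ∀ y : M, TangentSpace (𝓡 (n + 1)) y} (hX : ∀ k, SmoothFieldOn (X k) U)
    (hli : ∀ y ∈ U, LinearIndependent ℝ fun k => X k y) {x : M} (hx : x ∈ U) :
    ∃ V : Set M, IsOpen V ∧ x ∈ V ∧ V ⊆ U ∧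
      ∃ α : Fin (n + 1) → ∀ y : M, Module.Dual ℝ (TangentSpace (𝓡 (n + 1)) y),
        (∀ i, SmoothOneFormOn (α i) V) ∧ ∀ y ∈ V, IsDualFrame (fun i => α i y) fun k => X k y := by
  let φ := chartAt (EuclideanSpace ℝ (Fin (n + 1))) x
  have hφ : φ ∈ IsManifold.maximalAtlas (𝓡 (n + 1)) ∞ M := IsManifold.chart_mem_maximalAtlas x
  have hxφ : x ∈ φ.source := mem_chart_source _ x
  -- A has the frame as its columns. The rows of its inverse are the dual forms, and they are smooth
  -- because inversion is.
  let A : EuclideanSpace ℝ (Fin (n + 1)) → EuclideanSpace ℝ (Fin (n + 1)) →L[ℝ]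
    EuclideanSpace ℝ (Fin (n + 1)) := fun p => frameMap fun k => chartField φ (X k) p
  have hA : ∀ y ∈ U ∩ φ.source, ContDiffAt ℝ ∞ A (φ y) := fun y hy =>
    contDiffAt_frameMap fun k => (hX k).contDiffAt_chartField hφ hU hy.1 hy.2
  have hAX : ∀ y ∈ φ.source, A (φ y) = frameMap fun k => chartDeriv φ y (X k y) := by
    intro y hy
    simp only [A, chartField_apply _ hy]
  have hAi : ∀ y ∈ U ∩ φ.source, (A (φ y)).IsInvertible := by
    intro y hy
    rw [hAX y hy.2]
    refine isInvertible_frameMap ?_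
    obtain ⟨D, hD⟩ := isInvertible_chartDeriv hφ hy.2
    rw [← hD]
    exact (hli y hy.1).map' D.toLinearEquiv.toLinearMap D.toLinearEquiv.ker
  let b : Fin (n + 1) → EuclideanSpace ℝ (Fin (n + 1)) → EuclideanSpace ℝ (Fin (n + 1)) →L[ℝ] ℝ :=
    fun i p => (EuclideanSpace.proj i : EuclideanSpace ℝ (Fin (n + 1)) →L[ℝ] ℝ).comp (A p).inverse
  have hb : ∀ i, ∀ y ∈ U ∩ φ.source, ContDiffAt ℝ ∞ (b i) (φ y) := fun i y hy =>
    contDiffAt_const.clm_comp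
      (ContDiffAt.comp (φ y) (hAi y hy).contDiffAt_map_inverse (hA y hy))
  refine ⟨U ∩ φ.source, hU.inter φ.open_source, ⟨hx, hxφ⟩, inter_subset_left,
    fun i => formOfChart φ (b i), fun i => ?_, fun y hy => ?_⟩
  · refine smoothOneFormOn_of_chartForm fun y hy => ⟨φ, hφ, hy.2, ?_⟩
    refine (hb i y hy).congr_of_eventuallyEq ?_
    filter_upwards [φ.open_target.mem_nhds (φ.map_source hy.2)] with p hp
    ext u
    have h1 := chartForm_apply (formOfChart φ (b i)) (φ.map_target hp) u
    rw [φ.right_inv hp] at h1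
    rw [h1]
    change b i (φ (φ.symm p)) (chartDeriv φ (φ.symm p) ((chartDeriv φ (φ.symm p)).inverse u)) = _
    rw [(isInvertible_chartDeriv hφ (φ.map_target hp)).self_apply_inverse, φ.right_inv hp]
  · have hval : ∀ i v, formOfChart φ (b i) y v = (A (φ y)).inverse (chartDeriv φ y v) i :=
      fun i v => rfl
    constructor
    · intro i j
      have h1 : A (φ y) (EuclideanSpace.single j 1) = chartDeriv φ y (X j y) := by
        rw [hAX y hy.2, frameMap_apply]
        simp
      rw [hval, ← h1, (hAi y hy).inverse_apply_self]
      simp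
    · intro v
      obtain ⟨D, hD⟩ := isInvertible_chartDeriv hφ hy.2
      apply D.injective
      have h1 := (hAi y hy).self_apply_inverse (chartDeriv φ y v)
      rw [hAX y hy.2, frameMap_apply, ← hAX y hy.2] at h1
      have hD' : ∀ u, D u = chartDeriv φ y u := fun u => by rw [← hD]; rfl
      rw [map_sum, hD', ← h1]
      refine Finset.sum_congr rfl fun i _ => ?_
      rw [map_smul, hD', hval]

omit [IsManifold (𝓡 (n + 1)) ∞ M] in
-- By dimension the n+1 independent forms span the dual space, which separates vectors.
lemma eq_zero_of_coframe {y : M} {α : Fin (n + 1) → Module.Dual ℝ (TangentSpace (𝓡 (n + 1)) y)}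
    (hα : LinearIndependent ℝ α) {v : TangentSpace (𝓡 (n + 1)) y} (hv : ∀ i, α i v = 0) :
    v = 0 := by
  have hspan : Submodule.span ℝ (range α) = ⊤ := hα.span_eq_top_of_card_eq_finrank' (by
    rw [Subspace.dual_finrank_eq, finrank_tangentSpace, Fintype.card_fin])
  rw [← Module.forall_dual_apply_eq_zero_iff ℝ]
  intro a
  have ha : a ∈ Submodule.span ℝ (range α) := by rw [hspan]; trivial
  induction ha using Submodule.span_induction with
  | mem b hb => obtain ⟨i, rfl⟩ := hb; exact hv i
  | zero => rfl
  | add b c _ _ hb hc => simp [hb, hc]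
  | smul r b _ hb => simp [hb]

/-- A smooth coframe has a smooth dual frame. -/
lemma exists_dual_frame {U : Set M} (hU : IsOpen U)
    {α : Fin (n + 1) → ∀ y : M, Module.Dual ℝ (TangentSpace (𝓡 (n + 1)) y)}
    (hα : ∀ k, SmoothOneFormOn (α k) U)
    (hli : ∀ y ∈ U, LinearIndependent ℝ fun k => α k y) {x : M} (hx : x ∈ U) :
    ∃ V : Set M, IsOpen V ∧ x ∈ V ∧ V ⊆ U ∧
      ∃ X : Fin (n + 1) → ∀ y : M, TangentSpace (𝓡 (n + 1)) y,
        (∀ i, SmoothFieldOn (X i) V) ∧ ∀ y ∈ V, IsDualFrame (fun i => α i y) fun k => X k y := by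
  let φ := chartAt (EuclideanSpace ℝ (Fin (n + 1))) x
  have hφ : φ ∈ IsManifold.maximalAtlas (𝓡 (n + 1)) ∞ M := IsManifold.chart_mem_maximalAtlas x
  have hxφ : x ∈ φ.source := mem_chart_source _ x
  let A : EuclideanSpace ℝ (Fin (n + 1)) → EuclideanSpace ℝ (Fin (n + 1)) →L[ℝ]
    EuclideanSpace ℝ (Fin (n + 1)) := fun p => coframeMap fun k => chartForm φ (α k) p
  have hA : ∀ y ∈ U ∩ φ.source, ContDiffAt ℝ ∞ A (φ y) := fun y hy =>
    contDiffAt_coframeMap fun k => (hα k).contDiffAt_chartForm hφ hU hy.1 hy.2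
  have hAα : ∀ y ∈ φ.source, ∀ u i, A (φ y) u i = α i y ((chartDeriv φ y).inverse u) := by
    intro y hy u i
    rw [coframeMap_apply, chartForm_apply _ hy]
  have hAi : ∀ y ∈ U ∩ φ.source, (A (φ y)).IsInvertible := by
    intro y hy
    refine isInvertible_of_injective ((injective_iff_map_eq_zero _).2 fun u hu => ?_)
    have h1 : (chartDeriv φ y).inverse u = 0 := eq_zero_of_coframe (hli y hy.1) fun i => by
      rw [← hAα y hy.2, hu]; rfl
    rw [← (isInvertible_chartDeriv hφ hy.2).self_apply_inverse u, h1, map_zero]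
  refine ⟨U ∩ φ.source, hU.inter φ.open_source, ⟨hx, hxφ⟩, inter_subset_left,
    fun k => fieldOfChart φ fun p => (A p).inverse (EuclideanSpace.single k 1),
    fun k y hy => ?_, fun y hy => ?_⟩
  · refine (contMDiffAt_fieldOfChart hφ hy.2 ?_).contMDiffWithinAt
    exact (ContDiffAt.comp (φ y) (hAi y hy).contDiffAt_map_inverse (hA y hy)).clm_apply
      contDiffAt_const
  · have hpair : ∀ i k, α i y (fieldOfChart φ
        (fun p => (A p).inverse (EuclideanSpace.single k 1)) y) = if i = k then 1 else 0 := by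
      intro i k
      rw [fieldOfChart, ← hAα y hy.2, (hAi y hy).self_apply_inverse]
      simp
    refine ⟨hpair, fun v => ?_⟩
    rw [← sub_eq_zero]
    refine eq_zero_of_coframe (hli y hy.1) fun i => ?_
    rw [map_sub, map_sum]
    simp [hpair]

end DualFrames

/-! ### Charts adapted to foliations in general position. -/

section Coordinates

variable {m : ℕ} {M : Type*} [TopologicalSpace M] [ChartedSpace (EuclideanSpace ℝ (Fin m)) M]

/-- The differential of a map to a Euclidean space, with values in that space. -/
def euclideanDeriv {k : ℕ} (h : M → EuclideanSpace ℝ (Fin k)) (y : M) :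
    TangentSpace (𝓡 m) y →L[ℝ] EuclideanSpace ℝ (Fin k) :=
  mfderiv (𝓡 m) (𝓡 k) h y

lemma mfderiv_coord {k : ℕ} {h : M → EuclideanSpace ℝ (Fin k)} {y : M}
    (hh : MDifferentiableAt (𝓡 m) (𝓡 k) h y) (i : Fin k) (v : TangentSpace (𝓡 m) y) :
    mfderiv (𝓡 m) 𝓘(ℝ) (fun z => h z i) y v =
      euclideanDeriv h y v i := by
  have h1 : HasMFDerivAt (𝓡 k) 𝓘(ℝ) (EuclideanSpace.proj i : EuclideanSpace ℝ (Fin k) →L[ℝ] ℝ) (h y)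
      (EuclideanSpace.proj i : EuclideanSpace ℝ (Fin k) →L[ℝ] ℝ) :=
    (EuclideanSpace.proj i : EuclideanSpace ℝ (Fin k) →L[ℝ] ℝ).hasMFDerivAt
  have h2 := (h1.comp y hh.hasMFDerivAt).mfderiv
  exact congrArg (fun A => A v) h2

lemma mem_coordHyperplane {φ : OpenPartialHomeomorph M (EuclideanSpace ℝ (Fin m))}
    (hφ : φ ∈ IsManifold.maximalAtlas (𝓡 m) ∞ M) {y : M} (hy : y ∈ φ.source) (i : Fin m)
    (v : TangentSpace (𝓡 m) y) : v ∈ coordHyperplane φ i y ↔ chartDeriv φ y v i = 0 := by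
  rw [coordHyperplane, LinearMap.mem_ker]
  have := mfderiv_coord ((mdifferentiable_of_mem_maximalAtlas hφ).mdifferentiableAt hy) i v
  exact Eq.congr_left this

variable [IsManifold (𝓡 m) ∞ M]

/-- Codimension one foliations whose tangent hyperplanes are in general position are, locally, the
coordinate foliations of a chart. -/
theorem exists_adapted_chart (F : Fin m → Foliation m M 1)
    (hF : ∀ (y : M) (v : TangentSpace (𝓡 m) y), (∀ i, v ∈ (F i).T y) → v = 0) (x : M) :
    ∃ φ ∈ IsManifold.maximalAtlas (𝓡 m) ∞ M, x ∈ φ.source ∧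
      ∀ y ∈ φ.source, ∀ i, (F i).T y = coordHyperplane φ i y := by
  choose U hU hxU f hf hfT using fun i => (F i).exists_submersion x
  let V : Set M := ⋂ i, U i
  have hV : IsOpen V := isOpen_iInter_of_finite hU
  have hxV : x ∈ V := mem_iInter.2 hxU
  -- The local first integrals, taken together, are the candidate coordinates. General position says
  -- that dg is injective, and the inverse function theorem applies.
  let g : M → EuclideanSpace ℝ (Fin m) := fun z => WithLp.toLp 2 fun i => f i z 0
  have hfat : ∀ y ∈ V, ∀ i, ContMDiffAt (𝓡 m) (𝓡 1) ∞ (f i) y := fun y hy i =>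
    (hf i).contMDiffAt ((hU i).mem_nhds (mem_iInter.1 hy i))
  have hg : ∀ y ∈ V, ContMDiffAt (𝓡 m) (𝓡 m) ∞ g y := by
    intro y hy
    have h1 : ContMDiffAt (𝓡 m) 𝓘(ℝ, Fin m → ℝ) ∞ (fun z i => f i z 0) y := by
      rw [contMDiffAt_pi_space]
      intro i
      exact (EuclideanSpace.proj (0 : Fin 1) :
        EuclideanSpace ℝ (Fin 1) →L[ℝ] ℝ).contMDiff.contMDiffAt.comp y (hfat y hy i)
    exact (EuclideanSpace.equiv (Fin m) ℝ).symm.toContinuousLinearMap.contMDiff.contMDiffAt.comp y h1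
  have hT : ∀ y ∈ V, ∀ i, ∀ v : TangentSpace (𝓡 m) y, v ∈ (F i).T y ↔
      euclideanDeriv g y v i = 0 := by
    intro y hy i v
    rw [← mfderiv_coord ((hg y hy).mdifferentiableAt (by simp)) i v, (hfT i y (mem_iInter.1 hy i)).2,
      LinearMap.mem_ker]
    have h1 := mfderiv_coord ((hfat y hy i).mdifferentiableAt (by simp)) 0 v
    have h2 : mfderiv (𝓡 m) 𝓘(ℝ) (fun z => g z i) y v =
      euclideanDeriv (f i) y v 0 := h1
    rw [h2]
    constructor
    · intro h
      exact congrArg (fun u : EuclideanSpace ℝ (Fin 1) => u 0) h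
    · intro h
      change euclideanDeriv (f i) y v = 0
      ext j
      rw [Subsingleton.elim j 0]
      exact h
  have hinj : ∀ y ∈ V, Function.Injective (euclideanDeriv (m := m) g y) := by
    intro y hy
    refine (injective_iff_map_eq_zero _).2 fun v hv => hF y v fun i => ?_
    rw [hT y hy, hv]
    rfl
  let φ₀ := chartAt (EuclideanSpace ℝ (Fin m)) x
  have hφ₀ : φ₀ ∈ IsManifold.maximalAtlas (𝓡 m) ∞ M := IsManifold.chart_mem_maximalAtlas x
  have hxφ₀ : x ∈ φ₀.source := mem_chart_source _ x
  let G : EuclideanSpace ℝ (Fin m) → EuclideanSpace ℝ (Fin m) := fun p => g (φ₀.symm p)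
  have hG : ∀ y ∈ V ∩ φ₀.source, ContDiffAt ℝ ∞ G (φ₀ y) := fun y hy =>
    contDiffAt_comp_symm hφ₀ hy.2 (hg y hy.1)
  have hGi : ∀ y ∈ V ∩ φ₀.source, (fderiv ℝ G (φ₀ y)).IsInvertible := by
    intro y hy
    refine isInvertible_of_injective ((injective_iff_map_eq_zero _).2 fun u hu => ?_)
    have h1 := mfderiv_eq_fderiv_chart hφ₀ hy.2 (hg y hy.1) ((chartDeriv φ₀ y).inverse u)
    rw [(isInvertible_chartDeriv hφ₀ hy.2).self_apply_inverse] at h1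
    have h2 := (injective_iff_map_eq_zero _).1 (hinj y hy.1) _ (h1.trans hu)
    rw [← (isInvertible_chartDeriv hφ₀ hy.2).self_apply_inverse u, h2, map_zero]
  obtain ⟨A, hA⟩ := hGi x ⟨hxV, hxφ₀⟩
  have hGx := hG x ⟨hxV, hxφ₀⟩
  have hGd : HasFDerivAt G (A : EuclideanSpace ℝ (Fin m) →L[ℝ] EuclideanSpace ℝ (Fin m)) (φ₀ x) := by
    rw [hA]
    exact (hGx.differentiableAt (by simp)).hasFDerivAt
  let Θ := hGx.toOpenPartialHomeomorph G hGd (by simp)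
  have hxΘ : φ₀ x ∈ Θ.source := hGx.mem_toOpenPartialHomeomorph_source hGd (by simp)
  let φ := (φ₀.trans Θ).restrOpen V hV
  have hsrc : ∀ y, y ∈ φ.source ↔ (y ∈ φ₀.source ∧ φ₀ y ∈ Θ.source) ∧ y ∈ V := by
    intro y
    simp [φ]
  have hφg : ∀ y ∈ φ.source, φ y = g y := by
    intro y hy
    change g (φ₀.symm (φ₀ y)) = g y
    rw [φ₀.left_inv ((hsrc y).1 hy).1.1]
  have hφ : φ ∈ IsManifold.maximalAtlas (𝓡 m) ∞ M := by
    refine φ.mem_maximalAtlas_of_contMDiffOn ?_ ?_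
    · intro y hy
      exact ((hg y ((hsrc y).1 hy).2).contMDiffWithinAt).congr (fun z hz => hφg z hz) (hφg y hy)
    · intro p hp
      have hy := (hsrc _).1 (φ.map_target hp)
      have hp' : p ∈ Θ.target := by
        have := φ.right_inv hp
        rw [← this]
        exact Θ.map_source hy.1.2
      have hyp : φ₀ (φ.symm p) = Θ.symm p := by
        have h1 : φ.symm p = φ₀.symm (Θ.symm p) := rfl
        have h2 : Θ (φ₀ (φ.symm p)) = p := φ.right_inv hp
        rw [← Θ.left_inv hy.1.2, h2]
      -- The inverse is smooth at each point of the target, not just at the base point, since dg is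
      -- invertible on all of V; hence the restriction to V.
      obtain ⟨B, hB⟩ := hGi _ ⟨hy.2, hy.1.1⟩
      have hGy := hG _ ⟨hy.2, hy.1.1⟩
      rw [hyp] at hB hGy
      have h3 : ContDiffAt ℝ ∞ Θ.symm p := by
        refine Θ.contDiffAt_symm hp' (f₀' := B) ?_ hGy
        rw [hB]
        exact (hGy.differentiableAt (by simp)).hasFDerivAt
      have h4 : ContMDiffAt (𝓡 m) (𝓡 m) ∞ φ₀.symm (Θ.symm p) := by
        refine contMDiffAt_symm_of_mem_maximalAtlas hφ₀ ?_
        rw [← hyp]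
        exact φ₀.map_source hy.1.1
      exact (h4.comp p h3.contMDiffAt).contMDiffWithinAt
  refine ⟨φ, hφ, (hsrc x).2 ⟨⟨hxφ₀, hxΘ⟩, hxV⟩, fun y hy i => ?_⟩
  ext v
  rw [hT y ((hsrc y).1 hy).2, mem_coordHyperplane hφ hy]
  have h1 : chartDeriv φ y = euclideanDeriv g y := by
    apply Filter.EventuallyEq.mfderiv_eq
    filter_upwards [φ.open_source.mem_nhds hy] with z hz using hφg z hz
  rw [h1]

end Coordinates

/-! ### Operators with constant coefficients in a chart. -/

section ChartOperator

variable {m : ℕ} {M : Type*} [TopologicalSpace M] [ChartedSpace (EuclideanSpace ℝ (Fin m)) M]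

/-- The operator which is constant, equal to `A`, in the chart `φ`. -/
def chartOperator (φ : OpenPartialHomeomorph M (EuclideanSpace ℝ (Fin m)))
    (A : EuclideanSpace ℝ (Fin m) →L[ℝ] EuclideanSpace ℝ (Fin m)) (y : M) :
    TangentSpace (𝓡 m) y →ₗ[ℝ] TangentSpace (𝓡 m) y :=
  ((chartDeriv φ y).inverse.comp (A.comp (chartDeriv φ y))).toLinearMap

variable {φ : OpenPartialHomeomorph M (EuclideanSpace ℝ (Fin m))}

lemma chartDeriv_chartOperator (hφ : φ ∈ IsManifold.maximalAtlas (𝓡 m) ∞ M)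
    (A : EuclideanSpace ℝ (Fin m) →L[ℝ] EuclideanSpace ℝ (Fin m)) {y : M} (hy : y ∈ φ.source)
    (v : TangentSpace (𝓡 m) y) :
    chartDeriv φ y (chartOperator φ A y v) = A (chartDeriv φ y v) :=
  (isInvertible_chartDeriv hφ hy).self_apply_inverse _

lemma chartDeriv_injective (hφ : φ ∈ IsManifold.maximalAtlas (𝓡 m) ∞ M) {y : M}
    (hy : y ∈ φ.source) : Function.Injective (chartDeriv φ y) :=
  Function.LeftInverse.injective (isInvertible_chartDeriv hφ hy).inverse_apply_self

lemma chartField_chartOperator (hφ : φ ∈ IsManifold.maximalAtlas (𝓡 m) ∞ M)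
    (A : EuclideanSpace ℝ (Fin m) →L[ℝ] EuclideanSpace ℝ (Fin m))
    (X : ∀ x : M, TangentSpace (𝓡 m) x) {y : M} (hy : y ∈ φ.source) :
    chartField φ (fun z => chartOperator φ A z (X z)) =ᶠ[𝓝 (φ y)]
      fun p => A (chartField φ X p) := by
  filter_upwards [φ.open_target.mem_nhds (φ.map_source hy)] with p hp
  exact chartDeriv_chartOperator hφ A (φ.map_target hp) _

variable [IsManifold (𝓡 m) ∞ M]

/-- An operator with constant coefficients in a chart is a Nijenhuis operator. -/
theorem isNijenhuisOperatorOn_chartOperator (hφ : φ ∈ IsManifold.maximalAtlas (𝓡 m) ∞ M)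
    (A : EuclideanSpace ℝ (Fin m) →L[ℝ] EuclideanSpace ℝ (Fin m)) :
    IsNijenhuisOperatorOn (chartOperator φ A) φ.source := by
  have hsm : ∀ V : Set M, IsOpen V → V ⊆ φ.source → ∀ X : (∀ x : M, TangentSpace (𝓡 m) x),
      SmoothFieldOn X V → ∀ y ∈ V,
        ContDiffAt ℝ ∞ (chartField φ fun z => chartOperator φ A z (X z)) (φ y) := by
    intro V hV hVφ X hX y hy
    refine ContDiffAt.congr_of_eventuallyEq ?_ (chartField_chartOperator hφ A X (hVφ hy))
    exact A.contDiff.contDiffAt.comp _ (hX.contDiffAt_chartField hφ hV hy (hVφ hy))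
  refine ⟨fun V hV hVφ X hX => smoothFieldOn_of_chartField fun y hy =>
    ⟨φ, hφ, hVφ hy, hsm V hV hVφ X hX y hy⟩, fun V hV hVφ X Y hX hY y hy => ?_⟩
  have hyφ := hVφ hy
  have hXd := hX.contDiffAt_chartField hφ hV hy hyφ
  have hYd := hY.contDiffAt_chartField hφ hV hy hyφ
  have hAX := hsm V hV hVφ X hX y hy
  have hAY := hsm V hV hVφ Y hY y hy
  have eX := chartField_chartOperator hφ A X hyφ
  have eY := chartField_chartOperator hφ A Y hyφ
  apply chartDeriv_injective hφ hyφ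
  have key := lieBracket_const_operator A (hXd.differentiableAt (by simp))
    (hYd.differentiableAt (by simp))
  rw [map_zero, nijenhuisTorsion, map_sub, chartDeriv_mlieBracket hφ hyφ hAX hAY,
    chartDeriv_chartOperator hφ A hyφ, deformedBracket, map_sub, map_add,
    chartDeriv_mlieBracket hφ hyφ hAX hYd, chartDeriv_mlieBracket hφ hyφ hXd hAY,
    chartDeriv_chartOperator hφ A hyφ, chartDeriv_mlieBracket hφ hyφ hXd hYd,
    eX.lieBracket_vectorField_eq eY, eX.lieBracket_vectorField_eq EventuallyEq.rfl,
    EventuallyEq.rfl.lieBracket_vectorField_eq eY, key, sub_self]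

end ChartOperator

/-! ### Local extension of the operator of a web to a Nijenhuis operator. -/

section Diagonal

/-- The diagonal operator with eigenvalues `l`. -/
def diagonalOperator {k : ℕ} (l : Fin k → ℝ) :
    EuclideanSpace ℝ (Fin k) →L[ℝ] EuclideanSpace ℝ (Fin k) :=
  coframeMap fun i => l i • (EuclideanSpace.proj i : EuclideanSpace ℝ (Fin k) →L[ℝ] ℝ)

lemma diagonalOperator_apply {k : ℕ} (l : Fin k → ℝ) (u : EuclideanSpace ℝ (Fin k)) (i : Fin k) :
    diagonalOperator l u i = l i * u i := by
  rw [diagonalOperator, coframeMap_apply]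
  simp

variable {n : ℕ} {M : Type*} [TopologicalSpace M]
  [ChartedSpace (EuclideanSpace ℝ (Fin (n + 1))) M] [IsManifold (𝓡 (n + 1)) ∞ M]

lemma VeroneseWeb.exists_dual_frame (W : VeroneseWeb n M) (x : M) :
    ∃ U : Set M, IsOpen U ∧ x ∈ U ∧
      ∃ (α : Fin (n + 1) → ∀ y : M, Module.Dual ℝ (TangentSpace (𝓡 (n + 1)) y))
        (X : Fin (n + 1) → ∀ y : M, TangentSpace (𝓡 (n + 1)) y),
        (∀ i, SmoothFieldOn (X i) U) ∧ ∀ y ∈ U, IsDualFrame (fun i => α i y) (fun k => X k y) ∧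
          ∀ c : OnePoint ℝ, (W.F c).T y = LinearMap.ker (veroneseCurve (fun i => α i y) c) := by
  obtain ⟨U, hU, hxU, α, hα, h⟩ := W.exists_coframe x
  obtain ⟨V, hV, hxV, hVU, X, hX, hd⟩ :=
    VeroneseWebs.exists_dual_frame hU hα (fun y hy => (h y hy).1) hxU
  exact ⟨V, hV, hxV, α, X, hX, fun y hy => ⟨hd y hy, fun c =>
    eq_ker_of_dualAnnihilator_eq ((h y (hVU hy)).2 c)⟩⟩

lemma VeroneseWeb.eq_zero_of_mem (W : VeroneseWeb n M) {l : Fin (n + 1) → ℝ}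
    (hl : Function.Injective l) {y : M} {v : TangentSpace (𝓡 (n + 1)) y}
    (hv : ∀ i, v ∈ (W.F (l i : OnePoint ℝ)).T y) : v = 0 := by
  obtain ⟨U, -, hyU, α, X, -, h⟩ := W.exists_dual_frame y
  refine (h y hyU).1.eq_zero_of_veroneseCurve hl fun i => ?_
  have := hv i
  rwa [(h y hyU).2, LinearMap.mem_ker] at this

/-- In coordinates whose level hypersurfaces are leaves of `F_{l i}`, the partial operator of a web
is the restriction of the diagonal operator with eigenvalues `l i`. -/
theorem VeroneseWeb.exists_nijenhuis (W : VeroneseWeb n M)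
    (J : ∀ y : M, (W.F OnePoint.infty).T y →ₗ[ℝ] TangentSpace (𝓡 (n + 1)) y)
    (hJ : ∀ (c : ℝ) (y : M), (W.F (c : OnePoint ℝ)).T y =
      LinearMap.range (J y - c • ((W.F OnePoint.infty).T y).subtype))
    {l : Fin (n + 1) → ℝ} (hl : Function.Injective l) (hl0 : ∀ i, l i ≠ 0) (x : M) :
    ∃ φ ∈ IsManifold.maximalAtlas (𝓡 (n + 1)) ∞ M, x ∈ φ.source ∧
      ∃ N : ∀ y : M, TangentSpace (𝓡 (n + 1)) y →ₗ[ℝ] TangentSpace (𝓡 (n + 1)) y,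
        IsNijenhuisOperatorOn N φ.source ∧
        ∀ y ∈ φ.source,
          (∀ i, (W.F (l i : OnePoint ℝ)).T y = coordHyperplane φ i y) ∧
          (∀ i, N y (coordVector φ i y) = l i • coordVector φ i y) ∧
          (∀ v : (W.F OnePoint.infty).T y, N y v = J y v) ∧
          Function.Injective (N y) ∧
          ((W.F OnePoint.infty).T y).map (N y) = (W.F ((0 : ℝ) : OnePoint ℝ)).T y := by
  obtain ⟨φ, hφ, hxφ, hT⟩ := exists_adapted_chart (fun i => W.F (l i : OnePoint ℝ))
    (fun y v hv => W.eq_zero_of_mem hl hv) x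
  refine ⟨φ, hφ, hxφ, chartOperator φ (diagonalOperator l),
    isNijenhuisOperatorOn_chartOperator hφ _, fun y hy => ?_⟩
  have hNJ : ∀ v : (W.F OnePoint.infty).T y,
      chartOperator φ (diagonalOperator l) y v = J y v := by
    intro v
    apply chartDeriv_injective hφ hy
    rw [chartDeriv_chartOperator hφ _ hy]
    ext i
    -- (J - λ_i)v is tangent to F_{λ_i}, on which dx_i vanishes; this says dx_i(Jv) = λ_i dx_i(v).
    have h1 : (J y - l i • ((W.F OnePoint.infty).T y).subtype) v ∈
        (W.F (l i : OnePoint ℝ)).T y := by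
      rw [hJ]; exact ⟨v, rfl⟩
    rw [hT y hy, mem_coordHyperplane hφ hy] at h1
    have h2 : (J y - l i • ((W.F OnePoint.infty).T y).subtype) v = J y v - l i • v := rfl
    rw [h2, map_sub, map_smul] at h1
    rw [diagonalOperator_apply]
    exact (sub_eq_zero.1 h1).symm
  refine ⟨hT y hy, fun i => ?_, hNJ, ?_, ?_⟩
  · apply chartDeriv_injective hφ hy
    have h1 : chartDeriv φ y (coordVector φ i y) = EuclideanSpace.single i 1 :=
      (isInvertible_chartDeriv hφ hy).self_apply_inverse _
    rw [chartDeriv_chartOperator hφ _ hy, map_smul, h1]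
    ext j
    rw [diagonalOperator_apply]
    by_cases hij : j = i
    · subst hij; simp
    · simp [hij]
  · refine (injective_iff_map_eq_zero _).2 fun v hv => ?_
    apply chartDeriv_injective hφ hy
    have h1 := chartDeriv_chartOperator hφ (diagonalOperator l) hy v
    rw [hv, map_zero] at h1
    rw [map_zero]
    ext i
    have h2 := congrArg (fun u : EuclideanSpace ℝ (Fin (n + 1)) => u i) h1
    simp only [diagonalOperator_apply] at h2
    exact (mul_eq_zero.1 h2.symm).resolve_left (hl0 i)
  · rw [hJ, zero_smul, sub_zero]
    ext u
    simp only [Submodule.mem_map, LinearMap.mem_range]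
    constructor
    · rintro ⟨v, hv, rfl⟩
      exact ⟨⟨v, hv⟩, (hNJ ⟨v, hv⟩).symm⟩
    · rintro ⟨v, rfl⟩
      exact ⟨v, v.2, hNJ v⟩

end Diagonal

/-! ### From Veronese webs to partial Nijenhuis operators. -/

section WebToOperator

variable {n : ℕ} {M : Type*} [TopologicalSpace M]
  [ChartedSpace (EuclideanSpace ℝ (Fin (n + 1))) M]

lemma partialApply_of_mem {T : ∀ x : M, Submodule ℝ (TangentSpace (𝓡 (n + 1)) x)}
    (A : ∀ x : M, T x →ₗ[ℝ] TangentSpace (𝓡 (n + 1)) x) {x : M} {v : TangentSpace (𝓡 (n + 1)) x}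
    (hv : v ∈ T x) : partialApply A x v = A x ⟨v, hv⟩ := by
  rw [partialApply, dif_pos hv]

variable [IsManifold (𝓡 (n + 1)) ∞ M]

/-- The web `W` and the partial Nijenhuis operator `P` correspond to each other. -/
structure Corresponds (W : VeroneseWeb n M) (P : PartialNijenhuisOperator (n + 1) M 1) : Prop where
  infty : W.F OnePoint.infty = P.F
  coe : ∀ (c : ℝ) (x : M), (W.F (c : OnePoint ℝ)).T x = P.shiftedImage c x

/-- The partial operator attached to a web, at each point. -/
lemma VeroneseWeb.exists_operator (W : VeroneseWeb n M) (y : M) :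
    ∃ J : (W.F OnePoint.infty).T y →ₗ[ℝ] TangentSpace (𝓡 (n + 1)) y, ∀ c : ℝ,
      (W.F (c : OnePoint ℝ)).T y =
        LinearMap.range (J - c • ((W.F OnePoint.infty).T y).subtype) := by
  obtain ⟨U, -, hyU, α, X, -, h⟩ := W.exists_dual_frame y
  obtain ⟨hd, hT⟩ := h y hyU
  obtain ⟨J, hJ⟩ := hd.exists_shift (hT OnePoint.infty)
  exact ⟨J, fun c => by rw [hT, hd.range_shift (hT OnePoint.infty) hJ]⟩

/-- The web hypotheses on a family of partial operators give a partial Nijenhuis operator. -/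
lemma VeroneseWeb.exists_partialNijenhuisOperator (W : VeroneseWeb n M) :
    ∃ P : PartialNijenhuisOperator (n + 1) M 1, P.IsGeneric ∧ Corresponds W P := by
  choose J hJ' using W.exists_operator
  have hJ : ∀ (c : ℝ) (y : M), (W.F (c : OnePoint ℝ)).T y =
      LinearMap.range (J y - c • ((W.F OnePoint.infty).T y).subtype) := fun c y => hJ' y c
  -- The eigenvalues 1, …, n+1 are distinct and, because of the shift by one, nonzero, as the
  -- injectivity of N requires.
  have hl : Function.Injective (fun i : Fin (n + 1) => ((i : ℕ) : ℝ) + 1) := fun i j hij => by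
    simpa [Fin.ext_iff] using hij
  have hloc := W.exists_nijenhuis J hJ hl fun i => by positivity
  have hpN : ∀ {y : M} {N : TangentSpace (𝓡 (n + 1)) y →ₗ[ℝ] TangentSpace (𝓡 (n + 1)) y},
      (∀ v : (W.F OnePoint.infty).T y, N v = J y v) → ∀ v ∈ (W.F OnePoint.infty).T y, partialApply J y v = N v := by
    intro y N hN v hv
    rw [partialApply_of_mem J hv, ← hN ⟨v, hv⟩]
  have hsmooth : ∀ U : Set M, IsOpen U → ∀ X : (∀ x : M, TangentSpace (𝓡 (n + 1)) x),
      (W.F OnePoint.infty).IsSectionOn X U → SmoothFieldOn (fun x => partialApply J x (X x)) U := by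
    intro U hU X hX y hy
    obtain ⟨φ, hφ, hyφ, N, hN, h⟩ := hloc y
    have h1 := hN.smooth (U ∩ φ.source) (hU.inter φ.open_source) inter_subset_right X
      (ContMDiffOn.mono hX.1 inter_subset_left)
    refine ((h1.contMDiffAt (hU.inter φ.open_source) ⟨hy, hyφ⟩).congr_of_eventuallyEq
      ?_).contMDiffWithinAt
    filter_upwards [(hU.inter φ.open_source).mem_nhds ⟨hy, hyφ⟩] with z hz
    rw [hpN (h z hz.2).2.2.1 _ (hX.2 z hz.1)]
  -- comparison with a genuine Nijenhuis operator near a point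
  have hmain : ∀ U : Set M, IsOpen U → ∀ X Y : (∀ x : M, TangentSpace (𝓡 (n + 1)) x),
      (W.F OnePoint.infty).IsSectionOn X U → (W.F OnePoint.infty).IsSectionOn Y U → ∀ x ∈ U,
        deformedBracket (partialApply J) X Y x ∈ (W.F OnePoint.infty).T x ∧
          nijenhuisTorsion (partialApply J) X Y x = 0 := by
    intro U hU X Y hX hY x hx
    obtain ⟨φ, hφ, hxφ, N, hN, h⟩ := hloc x
    set V := U ∩ φ.source with hVdef
    have hV : IsOpen V := hU.inter φ.open_source
    have hxV : x ∈ V := ⟨hx, hxφ⟩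
    have hXV : SmoothFieldOn X V := ContMDiffOn.mono hX.1 inter_subset_left
    have hYV : SmoothFieldOn Y V := ContMDiffOn.mono hY.1 inter_subset_left
    have hev : ∀ Z : (∀ x : M, TangentSpace (𝓡 (n + 1)) x), (W.F OnePoint.infty).IsSectionOn Z U →
        (fun y => partialApply J y (Z y)) =ᶠ[𝓝 x] fun y => N y (Z y) := by
      intro Z hZ
      filter_upwards [hV.mem_nhds hxV] with z hz using hpN (h z hz.2).2.2.1 _ (hZ.2 z hz.1)
    -- Involutivity puts [X,Y] in TF. Outside TF, `partialApply` takes its default value 0 and the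
    -- comparison with N would fail.
    have hbr : VectorField.mlieBracket (𝓡 (n + 1)) X Y x ∈ (W.F OnePoint.infty).T x := (W.F OnePoint.infty).mlieBracket_mem hU hX hY hx
    have hdef : deformedBracket (partialApply J) X Y x =
        deformedBracket (fun y v => N y v) X Y x := by
      rw [deformedBracket, deformedBracket, (hev X hX).mlieBracket_vectorField_eq (EventuallyEq.refl _ Y),
        (EventuallyEq.refl _ X).mlieBracket_vectorField_eq (hev Y hY), hpN (h x hxφ).2.2.1 _ hbr]
    have htor := hN.torsion_eq_zero V hV inter_subset_right X Y hXV hYV x hxV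
    rw [nijenhuisTorsion, sub_eq_zero] at htor
    have hsec : ∀ Z : (∀ x : M, TangentSpace (𝓡 (n + 1)) x), (W.F OnePoint.infty).IsSectionOn Z U →
        (W.F ((0 : ℝ) : OnePoint ℝ)).IsSectionOn (fun y => N y (Z y)) V := by
      intro Z hZ
      refine ⟨hN.smooth V hV inter_subset_right Z (ContMDiffOn.mono hZ.1 inter_subset_left),
        fun y hy => ?_⟩
      rw [← (h y hy.2).2.2.2.2]
      exact ⟨Z y, hZ.2 y hy.1, rfl⟩
    have hmem : deformedBracket (partialApply J) X Y x ∈ (W.F OnePoint.infty).T x := by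
      -- [NX,NY] = N[X,Y]_N is tangent to F_0, so it equals Nu with u in TF; injectivity of N gives
      -- [X,Y]_N = u.
      have h1 := (W.F ((0 : ℝ) : OnePoint ℝ)).mlieBracket_mem hV (hsec X hX) (hsec Y hY) hxV
      rw [htor, ← (h x hxφ).2.2.2.2] at h1
      obtain ⟨u, hu, huN⟩ := h1
      rw [hdef, ← (h x hxφ).2.2.2.1 huN]
      exact hu
    refine ⟨hmem, ?_⟩
    rw [nijenhuisTorsion, (hev X hX).mlieBracket_vectorField_eq (hev Y hY), htor,
      hpN (h x hxφ).2.2.1 _ hmem, hdef, sub_self]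
  refine ⟨⟨W.F OnePoint.infty, J, hsmooth, fun U hU X Y hX hY x hx => (hmain U hU X Y hX hY x hx).1,
    fun U hU X Y hX hY x hx => (hmain U hU X Y hX hY x hx).2⟩, ?_, rfl, hJ⟩
  intro x
  obtain ⟨U, hU, hxU, α, X, hX, h⟩ := W.exists_dual_frame x
  -- The dual frame is shifted upwards while the frames of a generic operator are shifted downwards,
  -- so the order is reversed.
  refine ⟨U, hU, hxU, fun k => X k.rev.castSucc, fun k => X k.rev, fun k => hX _, fun k => hX _,
    fun y hy => ?_⟩
  obtain ⟨hd, hT⟩ := h y hy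
  have hJX : ∀ k : Fin n, J y ⟨X k.castSucc y, hd.mem_castSucc (hT OnePoint.infty) k⟩ =
      X k.succ y := by
    -- J was chosen point by point; uniqueness identifies it with the shift of the present smooth
    -- frame.
    obtain ⟨J', hJX'⟩ := hd.exists_shift (hT OnePoint.infty)
    have : J y = J' := hd.operator_unique (fun c => by rw [← hJ, hT])
      (fun c => (hd.range_shift (hT OnePoint.infty) hJX' c).le)
    rw [this]
    exact hJX'
  refine ⟨⟨?_, ?_⟩, ⟨?_, ?_⟩, fun k => ?_, fun k => ?_⟩
  · exact hd.linearIndependent.comp (fun k : Fin n => k.rev.castSucc)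
      ((Fin.castSucc_injective n).comp Fin.rev_injective)
  · rw [← hd.span_castSucc (hT OnePoint.infty)]
    congr 1
    exact Fin.rev_surjective.range_comp (fun k : Fin n => X k.castSucc y)
  · exact hd.linearIndependent.comp _ Fin.rev_injective
  · rw [← hd.span_eq_top]
    congr 1
    exact Fin.rev_surjective.range_comp (fun k => X k y)
  · rw [partialApply_of_mem J (hd.mem_castSucc (hT OnePoint.infty) k.rev), hJX]
    change X k.rev.succ y = X k.castSucc.rev y
    rw [Fin.rev_castSucc]
  · change X k.rev.castSucc y = X k.succ.rev y
    rw [Fin.rev_succ]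

end WebToOperator

/-! ### From partial Nijenhuis operators to Veronese webs. -/

section OperatorToWeb

variable {n : ℕ} {M : Type*} [TopologicalSpace M]
  [ChartedSpace (EuclideanSpace ℝ (Fin (n + 1))) M] [IsManifold (𝓡 (n + 1)) ∞ M]

/-- The field `(J - c) X`. -/
def PartialNijenhuisOperator.shiftedField (P : PartialNijenhuisOperator (n + 1) M 1) (c : ℝ)
    (X : ∀ x : M, TangentSpace (𝓡 (n + 1)) x) : ∀ x : M, TangentSpace (𝓡 (n + 1)) x :=
  (fun y => partialApply P.J y (X y)) + (-c) • X

variable (P : PartialNijenhuisOperator (n + 1) M 1)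

lemma PartialNijenhuisOperator.shiftedField_apply (c : ℝ)
    (X : ∀ x : M, TangentSpace (𝓡 (n + 1)) x) {y : M} (hy : X y ∈ P.F.T y) :
    P.shiftedField c X y = (P.J y - c • (P.F.T y).subtype) ⟨X y, hy⟩ := by
  change partialApply P.J y (X y) + (-c) • X y = P.J y ⟨X y, hy⟩ - c • X y
  rw [partialApply_of_mem P.J hy, neg_smul, sub_eq_add_neg]

lemma PartialNijenhuisOperator.shiftedField_mem (c : ℝ)
    {X : ∀ x : M, TangentSpace (𝓡 (n + 1)) x} {y : M} (hy : X y ∈ P.F.T y) :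
    P.shiftedField c X y ∈ P.shiftedImage c y :=
  ⟨⟨X y, hy⟩, (P.shiftedField_apply c X hy).symm⟩

/-- The distribution `(J - c) TF` is involutive. -/
theorem PartialNijenhuisOperator.mlieBracket_shiftedField_mem (c : ℝ) {U : Set M} (hU : IsOpen U)
    {X Y : ∀ x : M, TangentSpace (𝓡 (n + 1)) x} (hX : P.F.IsSectionOn X U)
    (hY : P.F.IsSectionOn Y U) {x : M} (hx : x ∈ U) :
    VectorField.mlieBracket (𝓡 (n + 1)) (P.shiftedField c X) (P.shiftedField c Y) x ∈
      P.shiftedImage c x := by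
  have : IsManifold (𝓡 (n + 1)) 2 M :=
    IsManifold.of_le (n := ∞) (WithTop.coe_le_coe.2 (le_top : (2 : ℕ∞) ≤ ⊤))
  have hd : ∀ {Z : ∀ x : M, TangentSpace (𝓡 (n + 1)) x}, SmoothFieldOn Z U →
      MDifferentiableAt (𝓡 (n + 1)) (𝓡 (n + 1)).tangent
        (fun x => (⟨x, Z x⟩ : TangentBundle (𝓡 (n + 1)) M)) x := fun hZ =>
    (hZ.contMDiffAt hU hx).mdifferentiableAt (by simp)
  have hX1 := hd hX.1
  have hY1 := hd hY.1
  have hJX := hd (P.smooth U hU X hX)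
  have hJY := hd (P.smooth U hU Y hY)
  have hbr := P.F.mlieBracket_mem hU hX hY hx
  have hdef := P.bracket_mem U hU X Y hX hY x hx
  have htor := P.torsion_eq_zero U hU X Y hX hY x hx
  rw [nijenhuisTorsion, sub_eq_zero, partialApply_of_mem P.J hdef] at htor
  have hcX := hd (ContMDiffOn.const_smul_section (a := -c) hX.1)
  have hcY := hd (ContMDiffOn.const_smul_section (a := -c) hY.1)
  have hexp : VectorField.mlieBracket (𝓡 (n + 1)) (P.shiftedField c X) (P.shiftedField c Y) x =
      (P.J x ⟨_, hdef⟩ + (-c) • VectorField.mlieBracket (𝓡 (n + 1))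
          (fun y => partialApply P.J y (X y)) Y x) +
        (-c) • (VectorField.mlieBracket (𝓡 (n + 1)) X (fun y => partialApply P.J y (Y y)) x +
          (-c) • VectorField.mlieBracket (𝓡 (n + 1)) X Y x) := by
    rw [PartialNijenhuisOperator.shiftedField, PartialNijenhuisOperator.shiftedField,
      VectorField.mlieBracket_add_left hJX hcX, VectorField.mlieBracket_const_smul_left hX1,
      VectorField.mlieBracket_add_right hJY hcY, VectorField.mlieBracket_add_right hJY hcY,
      VectorField.mlieBracket_const_smul_right hY1, VectorField.mlieBracket_const_smul_right hY1,
      htor]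
  have hd' : VectorField.mlieBracket (𝓡 (n + 1)) (fun y => partialApply P.J y (X y)) Y x =
      deformedBracket (partialApply P.J) X Y x + P.J x ⟨_, hbr⟩ -
        VectorField.mlieBracket (𝓡 (n + 1)) X (fun y => partialApply P.J y (Y y)) x := by
    rw [deformedBracket, partialApply_of_mem P.J hbr]
    abel
  -- The preimage is [X,Y]_J - c[X,Y]: expanding the bracket gives J[X,Y]_J - c([JX,Y] + [X,JY]) +
  -- c²[X,Y], whose middle sum is [X,Y]_J + J[X,Y].
  refine ⟨⟨_, hdef⟩ - c • ⟨_, hbr⟩, ?_⟩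
  rw [hexp, hd']
  simp only [LinearMap.sub_apply, LinearMap.smul_apply, map_sub, map_smul,
    Submodule.subtype_apply]
  module

/-- Near every point, a partial Nijenhuis operator of generic type shifts a frame of `TM` along
which `TF` is the kernel of the last form of the dual coframe. -/
lemma PartialNijenhuisOperator.IsGeneric.exists_dual_frame
    {P : PartialNijenhuisOperator (n + 1) M 1} (hP : P.IsGeneric) (x : M) :
    ∃ U : Set M, IsOpen U ∧ x ∈ U ∧
      ∃ (α : Fin (n + 1) → ∀ y : M, Module.Dual ℝ (TangentSpace (𝓡 (n + 1)) y))
        (X : Fin (n + 1) → ∀ y : M, TangentSpace (𝓡 (n + 1)) y),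
        (∀ i, SmoothOneFormOn (α i) U) ∧ (∀ k : Fin n, P.F.IsSectionOn (X k.castSucc) U) ∧
        ∀ y ∈ U, IsDualFrame (fun i => α i y) (fun k => X k y) ∧
          P.F.T y = LinearMap.ker (α (Fin.last n) y) ∧
          ∀ c : ℝ, P.shiftedImage c y =
            LinearMap.ker (veroneseCurve (fun i => α i y) (c : OnePoint ℝ)) := by
  obtain ⟨U, hU, hxU, v, w, hv, hw, h⟩ := hP x
  have hli : ∀ y ∈ U, LinearIndependent ℝ fun k : Fin (n + 1) => w k.rev y := fun y hy =>
    (h y hy).2.1.1.comp _ Fin.rev_injective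
  obtain ⟨V, hV, hxV, hVU, α, hα, hd⟩ :=
    exists_dual_coframe (X := fun k => w k.rev) hU (fun k => hw k.rev) hli hxU
  have hwv : ∀ y ∈ U, ∀ k : Fin n, w k.castSucc.rev y = v k.rev y := by
    intro y hy k
    rw [Fin.rev_castSucc, (h y hy).2.2.2 k.rev]
  have hvT : ∀ y ∈ U, ∀ k, v k y ∈ P.F.T y := by
    intro y hy k
    rw [← (h y hy).1.2]
    exact Submodule.subset_span (mem_range_self k)
  refine ⟨V, hV, hxV, α, fun k => w k.rev, hα, fun k =>
    ⟨ContMDiffOn.mono (hw _) hVU, fun y hy => ?_⟩, fun y hy => ?_⟩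
  · change w k.castSucc.rev y ∈ P.F.T y
    rw [hwv y (hVU hy)]
    exact hvT y (hVU hy) _
  have hT : P.F.T y = LinearMap.ker (α (Fin.last n) y) := by
    rw [← (h y (hVU hy)).1.2, ← (hd y hy).span_castSucc (T := LinearMap.ker (α (Fin.last n) y)) rfl]
    congr 1
    simp only [hwv y (hVU hy)]
    exact (Fin.rev_surjective.range_comp (fun k : Fin n => v k y)).symm
  refine ⟨hd y hy, hT, fun c => ?_⟩
  refine (hd y hy).range_shift hT (J := P.J y) (fun k => ?_) c
  have h1 := (h y (hVU hy)).2.2.1 k.rev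
  rw [partialApply_of_mem P.J (hvT y (hVU hy) _)] at h1
  rw [Fin.rev_succ, ← h1]
  congr 1
  exact Subtype.ext (hwv y (hVU hy) k)

omit [IsManifold (𝓡 (n + 1)) ∞ M] in
/-- A local first integral in a chart defines a submersion with the given kernels. -/
lemma exists_submersion_of_chart {φ : OpenPartialHomeomorph M (EuclideanSpace ℝ (Fin (n + 1)))}
    (hφ : φ ∈ IsManifold.maximalAtlas (𝓡 (n + 1)) ∞ M) {x : M} (hx : x ∈ φ.source)
    {T : ∀ y : M, Submodule ℝ (TangentSpace (𝓡 (n + 1)) y)}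
    {g : EuclideanSpace ℝ (Fin (n + 1)) → ℝ}
    (hg : ∀ᶠ y in 𝓝 x, ContDiffAt ℝ ∞ g (φ y) ∧ fderiv ℝ g (φ y) ≠ 0 ∧
      ∀ v, fderiv ℝ g (φ y) (chartDeriv φ y v) = 0 ↔ v ∈ T y) :
    ∃ U : Set M, IsOpen U ∧ x ∈ U ∧
      ∃ f : M → EuclideanSpace ℝ (Fin 1), ContMDiffOn (𝓡 (n + 1)) (𝓡 1) ∞ f U ∧
        ∀ y ∈ U, Function.Surjective (mfderiv (𝓡 (n + 1)) (𝓡 1) f y) ∧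
          T y = LinearMap.ker (mfderiv (𝓡 (n + 1)) (𝓡 1) f y).toLinearMap := by
  obtain ⟨U, hUs, hU, hxU⟩ := eventually_nhds_iff.1 (hg.and (φ.open_source.eventually_mem hx))
  let L : ℝ →L[ℝ] EuclideanSpace ℝ (Fin 1) :=
    ContinuousLinearMap.toSpanSingleton ℝ (EuclideanSpace.single 0 (1 : ℝ))
  have hL : ∀ r, L r 0 = r := fun r => by simp [L]
  let f : M → EuclideanSpace ℝ (Fin 1) := fun y => L (g (φ y))
  have hder : ∀ y ∈ U, ∀ v, euclideanDeriv (m := n + 1) f y v =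
      L (fderiv ℝ g (φ y) (chartDeriv φ y v)) := by
    intro y hy v
    obtain ⟨⟨h1, -⟩, h2⟩ := hUs y hy
    have h3 : HasFDerivAt (fun p => L (g p)) (L.comp (fderiv ℝ g (φ y))) (φ y) :=
      L.hasFDerivAt.comp (φ y) (h1.differentiableAt (by simp)).hasFDerivAt
    have h4 := (h3.hasMFDerivAt.comp y
      ((mdifferentiable_of_mem_maximalAtlas hφ).mdifferentiableAt h2).hasMFDerivAt).mfderiv
    exact congrArg (fun A => A v) h4
  refine ⟨U, hU, hxU, f, fun y hy => ?_, fun y hy => ⟨?_, ?_⟩⟩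
  · obtain ⟨⟨h1, -⟩, h2⟩ := hUs y hy
    have h3 : ContDiffAt ℝ ∞ (fun p => L (g p)) (φ y) := L.contDiff.contDiffAt.comp _ h1
    exact (h3.contMDiffAt.comp y (contMDiffAt_of_mem_maximalAtlas hφ h2)).contMDiffWithinAt
  · obtain ⟨⟨-, h1, -⟩, h2⟩ := hUs y hy
    obtain ⟨u, hu⟩ : ∃ u, fderiv ℝ g (φ y) u ≠ 0 := by
      by_contra! h
      exact h1 (ContinuousLinearMap.ext h)
    intro b
    let b' : EuclideanSpace ℝ (Fin 1) := b
    refine ⟨(chartDeriv φ y).inverse ((b' 0 / fderiv ℝ g (φ y) u) • u), ?_⟩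
    refine (hder y hy _).trans ?_
    change _ = b'
    rw [(isInvertible_chartDeriv hφ h2).self_apply_inverse, map_smul, smul_eq_mul,
      div_mul_cancel₀ _ hu]
    ext j
    rw [Subsingleton.elim j 0, hL]
  · obtain ⟨⟨-, -, h1⟩, h2⟩ := hUs y hy
    ext v
    rw [← h1, LinearMap.mem_ker]
    have h3 : euclideanDeriv (m := n + 1) f y v = 0 ↔ fderiv ℝ g (φ y) (chartDeriv φ y v) = 0 := by
      rw [hder y hy]
      refine ⟨fun h => ?_, fun h => by rw [h, map_zero]⟩
      rw [← hL (fderiv ℝ g (φ y) (chartDeriv φ y v)), h]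
      rfl
    exact h3.symm

/-- The distributions `(J - c) TF` are integrable. -/
theorem PartialNijenhuisOperator.IsGeneric.exists_submersion
    {P : PartialNijenhuisOperator (n + 1) M 1} (hP : P.IsGeneric) (c : ℝ) (x : M) :
    ∃ U : Set M, IsOpen U ∧ x ∈ U ∧
      ∃ f : M → EuclideanSpace ℝ (Fin 1), ContMDiffOn (𝓡 (n + 1)) (𝓡 1) ∞ f U ∧
        ∀ y ∈ U, Function.Surjective (mfderiv (𝓡 (n + 1)) (𝓡 1) f y) ∧
          P.shiftedImage c y = LinearMap.ker (mfderiv (𝓡 (n + 1)) (𝓡 1) f y).toLinearMap := by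
  obtain ⟨U, hU, hxU, α, X, hα, hX, h⟩ := hP.exists_dual_frame x
  let φ := chartAt (EuclideanSpace ℝ (Fin (n + 1))) x
  have hφ : φ ∈ IsManifold.maximalAtlas (𝓡 (n + 1)) ∞ M := IsManifold.chart_mem_maximalAtlas x
  have hxφ : x ∈ φ.source := mem_chart_source _ x
  let a : ∀ y : M, Module.Dual ℝ (TangentSpace (𝓡 (n + 1)) y) := fun y =>
    veroneseCurve (fun i => α i y) (c : OnePoint ℝ)
  let Y : Fin n → ∀ y : M, TangentSpace (𝓡 (n + 1)) y := fun k => P.shiftedField c (X k.castSucc)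
  have hY : ∀ k, SmoothFieldOn (Y k) U := fun k =>
    ContMDiffOn.add_section (P.smooth U hU _ (hX k))
      (ContMDiffOn.const_smul_section (a := -c) (hX k).1)
  have haY : ∀ k, ∀ y ∈ U, a y (Y k y) = 0 := by
    intro k y hy
    have h1 := P.shiftedField_mem c ((hX k).2 y hy)
    rwa [(h y hy).2.2 c, LinearMap.mem_ker] at h1
  have ha : ∀ y ∈ U, y ∈ φ.source → ContDiffAt ℝ ∞ (chartForm φ a) (φ y) := by
    intro y hy hyφ
    have h1 : chartForm φ a = fun p => ∑ i : Fin (n + 1), c ^ (i : ℕ) • chartForm φ (α i) p := by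
      funext p
      ext u
      simp [chartForm, a, veroneseCurve_coe]
    rw [h1]
    exact ContDiffAt.sum fun i _ =>
      ((hα i).contDiffAt_chartForm hφ hU hy hyφ).const_smul (c ^ (i : ℕ))
  have hane : ∀ y ∈ U, y ∈ φ.source → chartForm φ a (φ y) ≠ 0 := by
    intro y hy hyφ h0
    refine (h y hy).1.veroneseCurve_ne_zero (c : OnePoint ℝ) (LinearMap.ext fun v => ?_)
    have h1 := chartForm_apply a hyφ (chartDeriv φ y v)
    rw [h0, (isInvertible_chartDeriv hφ hyφ).inverse_apply_self] at h1
    exact h1.symm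
  have hev : ∀ᶠ p in 𝓝 (φ x), p ∈ φ.target ∧ φ.symm p ∈ U :=
    eventually_chart hxφ (hU.eventually_mem hxU)
  have hfield : ∀ k, ∀ y ∈ U, y ∈ φ.source →
      ∀ᶠ p in 𝓝 (φ y), chartForm φ a p (chartField φ (Y k) p) = 0 := by
    intro k y hy hyφ
    filter_upwards [eventually_chart hyφ (hU.eventually_mem hy)] with p hp
    have h1 := chartForm_apply a (φ.map_target hp.1) (chartField φ (Y k) p)
    rw [φ.right_inv hp.1, chartField, (isInvertible_chartDeriv hφ
      (φ.map_target hp.1)).inverse_apply_self, haY k _ hp.2] at h1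
    exact h1
  have hspan : ∀ y ∈ U, y ∈ φ.source → ∀ u, chartForm φ a (φ y) u = 0 →
      u ∈ Submodule.span ℝ (range fun k => chartField φ (Y k) (φ y)) := by
    intro y hy hyφ u hu
    rw [chartForm_apply a hyφ, ← LinearMap.mem_ker, ← (h y hy).2.2 c] at hu
    obtain ⟨t, ht⟩ := hu
    have h1 : u = chartDeriv φ y ((P.J y - c • (P.F.T y).subtype) t) := by
      rw [ht, (isInvertible_chartDeriv hφ hyφ).self_apply_inverse]
    obtain ⟨t, htT⟩ := t
    -- A copy of the membership is kept for the induction, since `htT` occurs inside the argument of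
    -- J.
    have ht2 := htT
    rw [← (h y hy).1.span_castSucc (h y hy).2.1] at ht2
    rw [h1]
    clear h1 ht
    induction ht2 using Submodule.span_induction with
    | mem b hb =>
      obtain ⟨k, rfl⟩ := hb
      refine Submodule.subset_span ⟨k, ?_⟩
      change chartField φ (Y k) (φ y) = _
      rw [chartField_apply _ hyφ]
      exact congrArg _ (P.shiftedField_apply c _ ((hX k).2 y hy))
    | zero =>
      have : (⟨0, htT⟩ : P.F.T y) = 0 := rfl
      rw [this, map_zero, map_zero]
      exact Submodule.zero_mem _
    | add b d hb hd ihb ihd =>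
      rw [(h y hy).1.span_castSucc (h y hy).2.1] at hb hd
      have : (⟨b + d, htT⟩ : P.F.T y) = ⟨b, hb⟩ + ⟨d, hd⟩ := rfl
      rw [this, map_add, map_add]
      exact Submodule.add_mem _ (ihb hb) (ihd hd)
    | smul r b hb ihb =>
      rw [(h y hy).1.span_castSucc (h y hy).2.1] at hb
      have : (⟨r • b, htT⟩ : P.F.T y) = r • ⟨b, hb⟩ := rfl
      rw [this, map_smul, map_smul]
      exact Submodule.smul_mem _ _ (ihb hb)
  have hclosed : ∀ y ∈ U, y ∈ φ.source → ∀ u v, chartForm φ a (φ y) u = 0 →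
      chartForm φ a (φ y) v = 0 → fderiv ℝ (chartForm φ a) (φ y) u v =
        fderiv ℝ (chartForm φ a) (φ y) v u := by
    intro y hy hyφ u v hu hv
    -- On ker a, which the fields Y_k span, the symmetry of the derivative is a bilinear condition,
    -- so it is checked on the Y_k; there it says that a([Y_j,Y_i]) = 0.
    have hframe : ∀ i j, fderiv ℝ (chartForm φ a) (φ y) (chartField φ (Y i) (φ y))
        (chartField φ (Y j) (φ y)) = fderiv ℝ (chartForm φ a) (φ y) (chartField φ (Y j) (φ y))
        (chartField φ (Y i) (φ y)) := by
      intro i j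
      have hYi := (hY i).contDiffAt_chartField hφ hU hy hyφ
      have hYj := (hY j).contDiffAt_chartField hφ hU hy hyφ
      have h1 := apply_lieBracket_of_ker ((ha y hy hyφ).differentiableAt (by simp))
        (hYj.differentiableAt (by simp)) (hYi.differentiableAt (by simp)) (hfield j y hy hyφ)
        (hfield i y hy hyφ)
      rw [← chartDeriv_mlieBracket hφ hyφ hYj hYi, chartForm_apply a hyφ,
        (isInvertible_chartDeriv hφ hyφ).inverse_apply_self] at h1
      have h2 := P.mlieBracket_shiftedField_mem c hU (hX j) (hX i) hy
      rw [(h y hy).2.2 c] at h2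
      exact sub_eq_zero.1 (h1.symm.trans h2)
    have hu' := hspan y hy hyφ u hu
    have hv' := hspan y hy hyφ v hv
    clear hu hv
    induction hu', hv' using Submodule.span_induction₂ with
    | mem_mem b d hb hd =>
      obtain ⟨i, rfl⟩ := hb
      obtain ⟨j, rfl⟩ := hd
      exact hframe i j
    | zero_left => simp
    | zero_right => simp
    | add_left b d e hb hd he h1 h2 => rw [map_add, map_add, ← h1, ← h2]; rfl
    | add_right b d e hb hd he h1 h2 => rw [map_add, map_add, h1, h2]; rfl
    | smul_left r b d hb hd h1 => rw [map_smul, map_smul, ← h1]; rfl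
    | smul_right r b d hb hd h1 => rw [map_smul, map_smul, h1]; rfl
  obtain ⟨g, hg⟩ := exists_first_integral (α := chartForm φ a) (p₀ := φ x)
    (hev.mono fun p hp => by
      have := ha _ hp.2 (φ.map_target hp.1)
      rwa [φ.right_inv hp.1] at this)
    (hane x hxU hxφ)
    (hev.mono fun p hp => by
      have := hclosed _ hp.2 (φ.map_target hp.1)
      rwa [φ.right_inv hp.1] at this)
  refine exists_submersion_of_chart hφ hxφ (g := g) ?_
  filter_upwards [(φ.continuousAt hxφ).eventually hg, φ.open_source.eventually_mem hxφ,
    hU.eventually_mem hxU] with y h1 h2 h3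
  refine ⟨h1.1, h1.2.1, fun v => ?_⟩
  rw [h1.2.2, chartForm_apply a h2, (isInvertible_chartDeriv hφ h2).inverse_apply_self,
    (h y h3).2.2 c, LinearMap.mem_ker]

/-- The family of foliations attached to a partial Nijenhuis operator of generic type. -/
lemma PartialNijenhuisOperator.IsGeneric.exists_veroneseWeb
    {P : PartialNijenhuisOperator (n + 1) M 1} (hP : P.IsGeneric) :
    ∃ W : VeroneseWeb n M, Corresponds W P := by
  let F : OnePoint ℝ → Foliation (n + 1) M 1 := fun c =>
    match c with
    | none => P.F
    | some c => ⟨P.shiftedImage c, hP.exists_submersion c⟩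
  refine ⟨⟨F, fun x => ?_⟩, rfl, fun c x => rfl⟩
  obtain ⟨U, hU, hxU, α, X, hα, hX, h⟩ := hP.exists_dual_frame x
  refine ⟨U, hU, hxU, α, hα, fun y hy => ⟨(h y hy).1.linearIndependent_dual, fun c => ?_⟩⟩
  rw [← dualAnnihilator_ker_eq_span]
  congr 1
  induction c using OnePoint.rec with
  | infty => exact (h y hy).2.1
  | coe c => exact (h y hy).2.2 c

end OperatorToWeb

/-! ### Uniqueness in both directions. -/

section Correspondence

variable {n : ℕ} {M : Type*} [TopologicalSpace M]
  [ChartedSpace (EuclideanSpace ℝ (Fin (n + 1))) M] [IsManifold (𝓡 (n + 1)) ∞ M]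

lemma Corresponds.web_unique {W W' : VeroneseWeb n M} {P : PartialNijenhuisOperator (n + 1) M 1}
    (h : Corresponds W P) (h' : Corresponds W' P) : W = W' := by
  refine VeroneseWeb.ext (funext fun c => ?_)
  induction c using OnePoint.rec with
  | infty => rw [h.infty, h'.infty]
  | coe c => exact Foliation.ext (funext fun x => by rw [h.coe, h'.coe])

lemma Corresponds.operator_unique {W : VeroneseWeb n M}
    {P P' : PartialNijenhuisOperator (n + 1) M 1}
    (h : Corresponds W P) (h' : Corresponds W P') : P = P' := by
  obtain ⟨F, J, h1, h2, h3⟩ := P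
  obtain ⟨F', J', h1', h2', h3'⟩ := P'
  -- The foliations are identified first, since the type of J depends on F.
  obtain rfl : F = F' := h.infty.symm.trans h'.infty
  obtain rfl : J = J' := by
    funext y
    obtain ⟨U, -, hyU, α, X, -, hd⟩ := W.exists_dual_frame y
    refine (hd y hyU).1.operator_unique (fun c => ?_) (fun c => ?_)
    · rw [← (hd y hyU).2]
      exact (h.coe c y).ge
    · rw [← (hd y hyU).2]
      exact (h'.coe c y).ge
  rfl

end Correspondence

end VeroneseWebs

end

open VeroneseWebs in
theorem mainTheorem1 (n : ℕ) (M : Type*) [TopologicalSpace M]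
    [ChartedSpace (EuclideanSpace ℝ (Fin (n + 1))) M] [IsManifold (𝓡 (n + 1)) ∞ M] :
    ∃ Φ : VeroneseWeb n M ≃
        {P : PartialNijenhuisOperator (n + 1) M 1 // P.IsGeneric},
      ∀ W : VeroneseWeb n M,
        W.F OnePoint.infty = (Φ W).1.F ∧
        (∀ x : M, (W.F ((0 : ℝ) : OnePoint ℝ)).T x = LinearMap.range ((Φ W).1.J x)) ∧
        (∀ (c : ℝ) (x : M), (W.F (c : OnePoint ℝ)).T x = (Φ W).1.shiftedImage c x) ∧
        ∀ l : Fin (n + 1) → ℝ, Function.Injective l → (∀ i, l i ≠ 0) → ∀ x : M,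
          ∃ φ ∈ IsManifold.maximalAtlas (𝓡 (n + 1)) ∞ M, x ∈ φ.source ∧
            ∃ J : ∀ y : M, TangentSpace (𝓡 (n + 1)) y →ₗ[ℝ] TangentSpace (𝓡 (n + 1)) y,
              IsNijenhuisOperatorOn J φ.source ∧
              ∀ y ∈ φ.source,
                (∀ i, (W.F (l i : OnePoint ℝ)).T y = coordHyperplane φ i y) ∧
                (∀ i, J y (coordVector φ i y) = l i • coordVector φ i y) ∧
                (∀ v : (Φ W).1.F.T y, J y v = (Φ W).1.J y v) ∧
                Set.InjOn (J y) ((Φ W).1.F.T y) ∧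
                ((Φ W).1.F.T y).map (J y) = (W.F ((0 : ℝ) : OnePoint ℝ)).T y := by
  choose f hfg hf using fun W : VeroneseWeb n M => W.exists_partialNijenhuisOperator
  let Ψ : VeroneseWeb n M → {P : PartialNijenhuisOperator (n + 1) M 1 // P.IsGeneric} :=
    fun W => ⟨f W, hfg W⟩
  -- Injectivity holds because an operator determines its web; surjectivity combines the web built
  -- from P with the uniqueness of the operator of a web.
  have hΨ : Function.Bijective Ψ := by
    refine ⟨fun W W' h => ?_, fun P => ?_⟩
    · have h1 : f W = f W' := congrArg Subtype.val h
      have h2 := hf W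
      rw [h1] at h2
      exact h2.web_unique (hf W')
    · obtain ⟨W, hW⟩ := P.2.exists_veroneseWeb
      exact ⟨W, Subtype.ext ((hf W).operator_unique hW)⟩
  refine ⟨Equiv.ofBijective Ψ hΨ, fun W => ?_⟩
  change W.F OnePoint.infty = (f W).F ∧
        (∀ x : M, (W.F ((0 : ℝ) : OnePoint ℝ)).T x = LinearMap.range ((f W).J x)) ∧
        (∀ (c : ℝ) (x : M), (W.F (c : OnePoint ℝ)).T x = (f W).shiftedImage c x) ∧ _
  obtain ⟨hinf, hcoe⟩ := hf W
  refine ⟨hinf, fun x => ?_, hcoe, fun l hl hl0 x => ?_⟩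
  · rw [hcoe, PartialNijenhuisOperator.shiftedImage, zero_smul, sub_zero]
  · change ∃ φ ∈ IsManifold.maximalAtlas (𝓡 (n + 1)) ∞ M, x ∈ φ.source ∧
            ∃ J : ∀ y : M, TangentSpace (𝓡 (n + 1)) y →ₗ[ℝ] TangentSpace (𝓡 (n + 1)) y,
              IsNijenhuisOperatorOn J φ.source ∧
              ∀ y ∈ φ.source,
                (∀ i, (W.F (l i : OnePoint ℝ)).T y = coordHyperplane φ i y) ∧
                (∀ i, J y (coordVector φ i y) = l i • coordVector φ i y) ∧
                (∀ v : (f W).F.T y, J y v = (f W).J y v) ∧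
                Set.InjOn (J y) ((f W).F.T y) ∧
                ((f W).F.T y).map (J y) = (W.F ((0 : ℝ) : OnePoint ℝ)).T y
    -- The chosen operator is generalised and destructured so that its foliation can be replaced by
    -- F_∞, on which `exists_nijenhuis` is stated.
    generalize f W = P at hinf hcoe
    obtain ⟨F, J, h1, h2, h3⟩ := P
    obtain rfl : W.F OnePoint.infty = F := hinf
    obtain ⟨φ, hφ, hx, N, hN, h⟩ := W.exists_nijenhuis J hcoe hl hl0 x
    refine ⟨φ, hφ, hx, N, hN, fun y hy => ?_⟩
    obtain ⟨h4, h5, h6, h7, h8⟩ := h y hy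
    exact ⟨h4, h5, h6, h7.injOn, h8⟩
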